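/- Work over $\mathbb{C}$. A \emph{family} is a sequence $(f_n)_n$ of polynomials, $f_n$ in finitely many variables; it is a \emph{p-family} if the number of variables and the degree of $f_n$ are bounded by a polynomial in $n$. VP is the class of p-families $(f_n)$ such that $f_n$ is computed by an arithmetic circuit (inputs: variables and constants of $\mathbb{C}$; gates $+,\times$) of size polynomially bounded in $n$. VNP is the class of p-families $(f_n)$ for which there is a family $(g_n)\in\mathrm{VP}$ with $f_n(x)=\sum_{e\in\{0,1\}^{u(n)}} g_n(x,e)$. A family $(f_n)$ is a \emph{p-projection} of $(h_n)$ if for some polynomially bounded $t$ every $f_n$ arises from $h_{t(n)}$ by substituting variables and constants for the variables. A family is \emph{VNP-complete} if it is in VNP and every family in VNP is a p-projection of it. For $k\ge 1$ the hyperpfaffian $\mathrm{Pf}_{k,n}$ is the polynomial of degree $n$ on $\bigotimes^{2k}\mathbb{C}^{2kn}$ given by $p\mapsto\langle e_1\wedge\cdots\wedge e_{2kn},\,p^{\otimes n}\rangle$, the wedge product being normalised so that $\langle e_1\wedge\cdots\wedge e_{2kn},\,e_{\pi(1)}\otimes\cdots\otimes e_{\pi(2kn)}\rangle=\mathrm{sgn}(\pi)$;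 in terms of the coordinates $p_{a_1,\dots,a_{2k}}$ of $p$, $$\mathrm{Pf}_{k,n}=\sum_{\pi\in S_{2kn}}\mathrm{sgn}(\pi)\prod_{i=0}^{n-1}p_{\pi(2ki+1),\dots,\pi(2ki+2k)} .$$ \textbf{Theorem.} Let $k\ge 1$ be fixed. (1) If $k$ is even, then the family $\mathrm{Pf}_k=(\mathrm{Pf}_{k,n})_n$ is VNP-complete; more generally, so is $(c_n\mathrm{Pf}_{k,n})_n$ for every sequence of nonzero $c_n\in\mathbb{C}$ (so the choice of scaling of $\mathrm{Pf}_{k,n}$ does not matter). (2) For every $d$, the value of $\mathrm{Pf}_{k,d}$ at the tensor $$\sum_{i,j=0}^{d-1}x_{i+1,j+1}\; e_{2ki+1}\otimes\cdots\otimes e_{2ki+k}\otimes e_{2kj+k+1}\otimes\cdots\otimes e_{2kj+2k},$$ with formal variables $x_{i,j}$, is $d!\,\mathrm{per}_d(x)$ if $k$ is even and $d!\,\det_d(x)$ if $k$ is odd. -/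

import Mathlib

open scoped BigOperators

/-! ### Arithmetic circuits -/

/-- A gate of an arithmetic circuit over `F` with input variables `σ`, placed after `m` earlier
gates: an input variable, a constant, or the sum or product of two earlier gates. -/
inductive ArithGate (F σ : Type) (m : ℕ) : Type where
  | var (x : σ) : ArithGate F σ m
  | const (c : F) : ArithGate F σ m
  | add (i j : Fin m) : ArithGate F σ m
  | mul (i j : Fin m) : ArithGate F σ m

/-- An arithmetic circuit with `s` gates (input gates and constants are counted), listed in a
topological order. A gate may be used any number of times by later gates. -/
inductive ArithCircuit (F σ : Type) : ℕ → Type where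
  | nil : ArithCircuit F σ 0
  | snoc {s : ℕ} (Γ : ArithCircuit F σ s) (g : ArithGate F σ s) : ArithCircuit F σ (s + 1)

noncomputable section

/-- The polynomial computed by a gate, given the polynomials computed by the earlier gates. -/
def ArithGate.value {F σ : Type} [CommSemiring F] {m : ℕ} (v : Fin m → MvPolynomial σ F) :
    ArithGate F σ m → MvPolynomial σ F
  | .var x => MvPolynomial.X x
  | .const c => MvPolynomial.C c
  | .add i j => v i + v j
  | .mul i j => v i * v j

/-- The polynomials computed at the gates of a circuit. -/
def ArithCircuit.value {F σ : Type} [CommSemiring F] :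
    {s : ℕ} → ArithCircuit F σ s → Fin s → MvPolynomial σ F
  | _, .nil => Fin.elim0
  | _, .snoc Γ g =>
      Fin.snoc (α := fun _ => MvPolynomial σ F) Γ.value (g.value Γ.value)

/-- `f` is computed, at some gate, by an arithmetic circuit with `s` gates. -/
def HasCircuitOfSize {F σ : Type} [CommSemiring F] (f : MvPolynomial σ F) (s : ℕ) : Prop :=
  ∃ (Γ : ArithCircuit F σ s) (i : Fin s), Γ.value i = f

/-! ### Valiant's classes

A family of polynomials is a sequence `f n`, where `f n` is a polynomial over `F` in a finite set
`σ n` of variables. -/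

/-- A function `t : ℕ → ℕ` that is bounded above by a polynomial. -/
def PBounded (t : ℕ → ℕ) : Prop :=
  ∃ q : Polynomial ℕ, ∀ n, t n ≤ q.eval n

/-- A p-family: the number of variables and the degree are polynomially bounded. -/
def IsPFamily {F : Type} [CommSemiring F] {σ : ℕ → Type} [∀ n, Fintype (σ n)]
    (f : ∀ n, MvPolynomial (σ n) F) : Prop :=
  PBounded (fun n => Fintype.card (σ n)) ∧ PBounded (fun n => (f n).totalDegree)

/-- The class VP: p-families computed by arithmetic circuits of polynomially bounded size. -/
def IsVP {F : Type} [CommSemiring F] {σ : ℕ → Type} [∀ n, Fintype (σ n)]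
    (f : ∀ n, MvPolynomial (σ n) F) : Prop :=
  IsPFamily f ∧ ∃ s : ℕ → ℕ, PBounded s ∧ ∀ n, HasCircuitOfSize (f n) (s n)

/-- The sum of `g(x, e)` over all `e ∈ {0,1}^u`, a polynomial in `x`. -/
def booleanSum {F σ : Type} [CommSemiring F] {u : ℕ} (g : MvPolynomial (σ ⊕ Fin u) F) :
    MvPolynomial σ F :=
  ∑ e : Fin u → Bool,
    MvPolynomial.aeval
      (Sum.elim (fun x => (MvPolynomial.X x : MvPolynomial σ F))
        (fun i => if e i then (1 : MvPolynomial σ F) else 0)) g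

/-- The class VNP: p-families `f n = ∑_{e ∈ {0,1}^(u n)} g n (x, e)` with `g` in VP. -/
def IsVNP {F : Type} [CommSemiring F] {σ : ℕ → Type} [∀ n, Fintype (σ n)]
    (f : ∀ n, MvPolynomial (σ n) F) : Prop :=
  IsPFamily f ∧
    ∃ (u : ℕ → ℕ) (g : ∀ n, MvPolynomial (σ n ⊕ Fin (u n)) F),
      IsVP g ∧ ∀ n, f n = booleanSum (g n)

/-- `f` is a projection of `g`: it arises from `g` by replacing each variable of `g` by a variable
of `f` or by a constant. -/
def IsProjection {F σ τ : Type} [CommSemiring F] (f : MvPolynomial σ F) (g : MvPolynomial τ F) :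
    Prop :=
  ∃ a : τ → σ ⊕ F,
    f = MvPolynomial.aeval
      (fun y => Sum.elim (fun x => MvPolynomial.X x) (fun c => MvPolynomial.C c) (a y)) g

/-- The family `f` is a p-projection of the family `g`. -/
def IsPProjection {F : Type} [CommSemiring F] {σ τ : ℕ → Type}
    (f : ∀ n, MvPolynomial (σ n) F) (g : ∀ n, MvPolynomial (τ n) F) : Prop :=
  ∃ t : ℕ → ℕ, PBounded t ∧ ∀ n, IsProjection (f n) (g (t n))

/-- VNP-completeness, with respect to p-projections. -/
def IsVNPComplete {F : Type} [CommSemiring F] {τ : ℕ → Type} [∀ n, Fintype (τ n)]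
    (g : ∀ n, MvPolynomial (τ n) F) : Prop :=
  IsVNP g ∧
    ∀ (σ : ℕ → Type) [∀ n, Fintype (σ n)] (f : ∀ n, MvPolynomial (σ n) F),
      IsVNP f → IsPProjection f g

/-! ### Hyperpfaffians -/

/-- The coordinates on `⨂^(2k) ℂ^(2kn)`: the variable `a` is the coefficient of
`e_{a 0} ⊗ ⋯ ⊗ e_{a (2k-1)}`. -/
abbrev TensorIndex (k n : ℕ) : Type := Fin (2 * k) → Fin (n * (2 * k))

/-- The hyperpfaffian `Pf_{k,n}`, a polynomial function of degree `n` on `⨂^(2k) ℂ^(2kn)`. It is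
`p ↦ ⟨e_1 ∧ ⋯ ∧ e_{2kn}, p^{⊗ n}⟩`, where the wedge product is the alternating tensor whose
pairing with `e_{π(1)} ⊗ ⋯ ⊗ e_{π(2kn)}` is the sign of `π`. Note that `finProdFinEquiv (i, j)` is
position `2k·i + j`, the `j`-th position in the `i`-th block of length `2k`. -/
def hyperpfaffian (k n : ℕ) : MvPolynomial (TensorIndex k n) ℂ :=
  ∑ π : Equiv.Perm (Fin (n * (2 * k))),
    MvPolynomial.C (((Equiv.Perm.sign π : ℤ) : ℂ)) *
      ∏ i : Fin n, MvPolynomial.X (fun j : Fin (2 * k) => π (finProdFinEquiv (i, j)))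

/-- The multi-index of (counting from 0)
`e_{2ki} ⊗ ⋯ ⊗ e_{2ki+k-1} ⊗ e_{2kj+k} ⊗ ⋯ ⊗ e_{2kj+2k-1}`. -/
def blockIndex (k d : ℕ) (i j : Fin d) : TensorIndex k d :=
  fun l => finProdFinEquiv (if (l : ℕ) < k then i else j, l)

/-- The coordinates of the tensor `∑_{i,j} x_{i,j} • e_{blockIndex i j}`, whose entries are linear
forms in the `d²` variables `x_{i,j}`. -/
def blockTensor (k d : ℕ) (a : TensorIndex k d) : MvPolynomial (Fin d × Fin d) ℂ :=
  ∑ i : Fin d, ∑ j : Fin d, if a = blockIndex k d i j then MvPolynomial.X (i, j) else 0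

end

/-! Part (2) is an expansion. At the block tensor a permutation of the basis contributes only if it
moves the first halves of the blocks by some α in S_d and the second halves by some β. Its sign is
sgn(αβ⁻¹)^k, its monomial depends only on αβ⁻¹, and every value of αβ⁻¹ occurs d! times
(`aeval_blockTensor_hyperpfaffian`). The coordinates of the block tensor are variables or 0, so for
even k the polynomial d!·per_d is a projection of the hyperpfaffian, and hardness reduces to writing
any prescribed multiple of a VNP polynomial as a small permanent of variables and constants.

That is done with generating functions over ℂ instead of graph gadgets. (a) After removal of
constant terms, the gates of a circuit solve a triangular quadratic system. The coefficient of a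
monomial in a gate is a sum over vectors y of rule multiplicities that satisfy a linear balance
condition, with weight ∏ out_v! · ∏ c_ρ^{y_ρ}/y_ρ! (`PolySystem.coeff_prod_pow_eq_count`). (b) A
Boolean sum of the circuit is therefore a sum, over the integer points of a box, of a product of
functions of integer linear forms. Each such function is interpolated by a polynomial that splits
into affine factors; powers of variables with exponents depending on y are produced by auxiliary
coordinates (`PolySystem.exists_isAffineProd_booleanSum`). (c) A sum over a box of products of
affine forms involves the box only through the power sums ∑ b^k. These can be prescribed as
coefficients of a binary form, which splits into linear forms, and these become extra rows of a
matrix with repeated columns (`exists_permanent_eq_sum_prod_affine`).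

Membership in VNP: the hyperpfaffian is a sum over 0-1-matrices, cut down to permutation matrices by
polynomials that detect them and compute their signs (`booleanSum_hyperpfaffianWitness`). -/

/-! ### Permanents with repeated columns -/

/-- A binary form over an algebraically closed field is a product of linear forms. -/
theorem exists_prod_linear_eq_binary_form {A : Type} [CommRing A] [Algebra ℂ A] :
    ∀ (M : ℕ) (w : ℕ → ℂ), ∃ β γ : Fin (M + 1) → ℂ, ∀ z t : A,
      ∏ r, (β r • z + γ r • t) =
        ∑ k ∈ Finset.range (M + 1 + 1), w k • (z ^ (M + 1 - k) * t ^ k)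
  -- The induction starts in degree 1, since a form of degree 0 need not equal the empty product.
  | 0, w => ⟨fun _ => w 0, fun _ => w 1, fun z t => by
      simp [Finset.sum_range_succ]⟩
  | M + 1, w => by
    by_cases hw : w (M + 2) = 0
    · obtain ⟨β, γ, h⟩ := exists_prod_linear_eq_binary_form (A := A) M w
      -- Without a pure power of t the form is divisible by z.
      refine ⟨Fin.cons 1 β, Fin.cons 0 γ, fun z t => ?_⟩
      rw [Fin.prod_univ_succ, Finset.sum_range_succ]
      simp only [Fin.cons_zero, Fin.cons_succ, h, hw, zero_smul, add_zero, one_smul,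
        Finset.mul_sum]
      refine Finset.sum_congr rfl fun k hk => ?_
      have hk' : M + 1 + 1 - k = (M + 1 - k) + 1 := by
        have := Finset.mem_range.1 hk; omega
      rw [hk', mul_smul_comm]
      ring_nf
    · set p : Polynomial ℂ := ∑ k ∈ Finset.range (M + 3), Polynomial.monomial k (w k) with hp
      have hcoeff : ∀ k, p.coeff k = if k < M + 3 then w k else 0 := by
        intro k
        simp [hp, Polynomial.finsetSum_coeff, Polynomial.coeff_monomial]
      have hdeg : p.natDegree ≤ M + 2 := by
        rw [Polynomial.natDegree_le_iff_coeff_eq_zero]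
        intro N hN
        rw [hcoeff, if_neg (by omega)]
      have hdeg2 : M + 2 ≤ p.natDegree := by
        apply Polynomial.le_natDegree_of_ne_zero
        rw [hcoeff, if_pos (by omega)]
        exact hw
      -- Dehomogenised at z = 1, a root x gives the linear factor t - x z; the cofactor `q` has
      -- degree one less.
      obtain ⟨x, hx⟩ := IsAlgClosed.exists_root p (by
        intro h0
        have : p.natDegree = 0 := Polynomial.natDegree_eq_of_degree_eq_some h0
        omega)
      obtain ⟨q, hq⟩ := Polynomial.dvd_iff_isRoot.2 hx
      have hq0 : q ≠ 0 := by
        rintro rfl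
        rw [mul_zero] at hq
        rw [hq] at hdeg2
        simp at hdeg2
      have hqdeg : q.natDegree ≤ M + 1 := by
        have := Polynomial.natDegree_mul (Polynomial.X_sub_C_ne_zero x) hq0
        rw [← hq, Polynomial.natDegree_X_sub_C] at this
        omega
      obtain ⟨β, γ, h⟩ := exists_prod_linear_eq_binary_form (A := A) M q.coeff
      refine ⟨Fin.cons (-x) β, Fin.cons 1 γ, fun z t => ?_⟩
      rw [Fin.prod_univ_succ]
      simp only [Fin.cons_zero, Fin.cons_succ, h]
      have hw0 : w 0 = -x * q.coeff 0 := by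
        have := hcoeff 0
        rw [if_pos (by omega), hq] at this
        rw [← this]
        simp [Polynomial.mul_coeff_zero]
      have hws : ∀ k, k < M + 2 → w (k + 1) = q.coeff k - x * q.coeff (k + 1) := by
        intro k hk
        have := hcoeff (k + 1)
        rw [if_pos (by omega), hq, sub_mul, Polynomial.coeff_sub, Polynomial.coeff_X_mul,
          Polynomial.coeff_C_mul] at this
        exact this.symm
      have hqtop : q.coeff (M + 2) = 0 :=
        Polynomial.coeff_eq_zero_of_natDegree_lt (by omega)
      rw [one_smul, add_mul, add_comm]
      have e1 : t * ∑ k ∈ Finset.range (M + 1 + 1), q.coeff k • (z ^ (M + 1 - k) * t ^ k) =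
          ∑ k ∈ Finset.range (M + 2), q.coeff k • (z ^ (M + 2 - (k + 1)) * t ^ (k + 1)) := by
        rw [Finset.mul_sum]
        refine Finset.sum_congr rfl fun k hk => ?_
        have : M + 2 - (k + 1) = M + 1 - k := by omega
        rw [this, mul_smul_comm]
        ring_nf
      have e2 : (-x) • z * ∑ k ∈ Finset.range (M + 1 + 1), q.coeff k • (z ^ (M + 1 - k) * t ^ k) =
          ∑ k ∈ Finset.range (M + 3), (-x * q.coeff k) • (z ^ (M + 2 - k) * t ^ k) := by
        rw [Finset.sum_range_succ _ (M + 2), hqtop, Finset.mul_sum, mul_zero, zero_smul, add_zero]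
        refine Finset.sum_congr rfl fun k hk => ?_
        have : M + 2 - k = (M + 1 - k) + 1 := by
          have := Finset.mem_range.1 hk; omega
        rw [this, mul_smul_comm, smul_mul_assoc, smul_smul, mul_comm (q.coeff k)]
        ring_nf
      rw [e1, e2, Finset.sum_range_succ' _ (M + 2), Finset.sum_range_succ' _ (M + 1 + 1), ← add_assoc,
        ← Finset.sum_add_distrib, ← hw0]
      congr 1
      refine Finset.sum_congr rfl fun k hk => ?_
      rw [hws k (Finset.mem_range.1 hk), ← add_smul]
      congr 1
      ring

/-- The number of ways to factor `φ` through a permutation followed by `π`. -/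
theorem card_perm_comp_eq {n K : Type} [Fintype n] [DecidableEq n] [Fintype K] [DecidableEq K]
    (π φ : n → K) :
    (Finset.univ.filter fun g : Equiv.Perm n => π ∘ g = φ).card =
      if (∀ k, Fintype.card {a // φ a = k} = Fintype.card {a // π a = k}) then
        ∏ k, (Fintype.card {a // π a = k}).factorial else 0 := by
  split_ifs with h
  -- One solution `g₀` makes the set of all solutions a coset of the stabiliser of `π`, whose order
  -- is the product of the factorials of the fibre sizes.
  · let g₀ : Equiv.Perm n := Equiv.ofFiberEquiv (f := φ) (g := π)
      fun k => Fintype.equivOfCardEq (h k)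
    have hg₀ : ∀ a, π (g₀ a) = φ a := fun a => Equiv.ofFiberEquiv_map _ a
    rw [← DomMulAct.stabilizer_card π, Fintype.card_subtype]
    refine Finset.card_bij (fun g _ => g * g₀⁻¹) ?_ ?_ ?_
    · intro g hg
      simp only [Finset.mem_filter, Finset.mem_univ, true_and] at hg ⊢
      funext a
      have := congrFun hg (g₀⁻¹ a)
      simp only [Function.comp_apply] at this
      simp only [Function.comp_apply, Equiv.Perm.mul_apply, this, ← hg₀]
      simp
    · intro g _ g' _ hgg
      exact mul_right_cancel hgg
    · intro g hg
      simp only [Finset.mem_filter, Finset.mem_univ, true_and] at hg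
      refine ⟨g * g₀, ?_, by simp⟩
      simp only [Finset.mem_filter, Finset.mem_univ, true_and]
      funext a
      have := congrFun hg (g₀ a)
      simp only [Function.comp_apply] at this
      simp [this, hg₀]
  · rw [Finset.card_eq_zero, Finset.filter_eq_empty_iff]
    rintro g - hg
    refine h fun k => Fintype.card_congr ⟨fun a => ⟨g a, ?_⟩, fun a => ⟨g.symm a, ?_⟩, ?_, ?_⟩
    · exact (congrFun hg a).trans a.2
    · rw [← hg, Function.comp_apply, Equiv.apply_symm_apply]; exact a.2
    · intro a; simp
    · intro a; simp

/-- The permanent of a matrix with repeated columns, as a coefficient of a product of linear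
forms. -/
theorem permanent_repeated_columns {R n K : Type} [CommRing R] [Fintype n] [DecidableEq n]
    [Fintype K] [DecidableEq K] (π : n → K) (B : n → K → R) (α : K →₀ ℕ)
    (hα : ∀ k, α k = Fintype.card {a // π a = k}) :
    (Matrix.of fun r c => B r (π c)).permanent =
      ((∏ k, (α k).factorial : ℕ) : R) *
        MvPolynomial.coeff α (∏ r, ∑ k, MvPolynomial.C (B r k) * MvPolynomial.X k) := by
  have hexp : (∏ r, ∑ k, MvPolynomial.C (B r k) * MvPolynomial.X k : MvPolynomial K R) =
      ∑ φ : n → K, MvPolynomial.monomial (∑ r, Finsupp.single (φ r) 1) (∏ r, B r (φ r)) := by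
    rw [Finset.prod_univ_sum, Fintype.piFinset_univ]
    refine Finset.sum_congr rfl fun φ _ => ?_
    rw [MvPolynomial.monomial_sum_prod]
    refine Finset.prod_congr rfl fun r _ => ?_
    rw [MvPolynomial.C_mul_X_eq_monomial]
  have hperm : (Matrix.of fun r c => B r (π c)).permanent =
      ∑ σ : Equiv.Perm n, ∏ r, B r (π (σ r)) := by
    rw [Matrix.permanent]
    refine Fintype.sum_equiv (Equiv.inv _) _ _ fun σ => ?_
    refine Fintype.prod_equiv σ _ _ fun r => ?_
    simp
  have hcnt : ∀ φ : n → K, (∑ r, Finsupp.single (φ r) 1 = α) ↔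
      ∀ k, Fintype.card {a // φ a = k} = Fintype.card {a // π a = k} := by
    intro φ
    rw [Finsupp.ext_iff]
    refine forall_congr' fun k => ?_
    rw [Finsupp.finsetSum_apply, hα, Fintype.card_subtype (fun a => φ a = k), Finset.card_filter]
    simp only [Finsupp.single_apply]
  -- Permutations are grouped by the colouring φ = π ∘ σ of the rows, which alone determines the
  -- product of entries.
  rw [hperm, hexp, MvPolynomial.coeff_sum, Finset.mul_sum,
    ← Finset.sum_fiberwise (s := Finset.univ) (g := fun σ : Equiv.Perm n => π ∘ σ)]
  refine Finset.sum_congr rfl fun φ _ => ?_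
  rw [MvPolynomial.coeff_monomial]
  have : ∀ σ ∈ Finset.univ.filter (fun σ : Equiv.Perm n => π ∘ σ = φ),
      ∏ r, B r (π (σ r)) = ∏ r, B r (φ r) := by
    intro σ hσ
    rw [← (Finset.mem_filter.1 hσ).2]; rfl
  rw [Finset.sum_congr rfl this, Finset.sum_const, card_perm_comp_eq, nsmul_eq_mul]
  simp only [← hα, hcnt]
  split_ifs <;> simp

/-! ### Box sums of products of affine forms as permanents -/

/-- The coordinates of an integer vector, with an additional coordinate `1`. -/
def affineCoord {ι : Type} {B : ℕ} (y : ι → Fin (B + 1)) (i : Option ι) : ℕ :=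
  i.elim 1 fun i => y i

/-- The colour of a column: `none` for the columns shared by all the absorbing rows. -/
def columnColour {ι : Type} {M : ℕ} : Fin (M + 1) ⊕ (Option ι × Fin (M + 1)) → Option (Option ι) :=
  Sum.elim (fun _ => none) (fun p => some p.1)

/-- The entries, in the columns of each colour, of the matrix whose permanent is a sum of products
of affine forms: `M + 1` rows are given by the affine forms, and `M + 1` rows for each coordinate
absorb the columns of that colour that are left over. -/
def absorbingEntry {ι : Type} [DecidableEq ι] {R : Type} [Zero R] {M : ℕ}
    (a : Fin (M + 1) → Option ι → R) (β γ : Option ι → Fin (M + 1) → R) :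
    Fin (M + 1) ⊕ (Option ι × Fin (M + 1)) → Option (Option ι) → R
  | .inl _, none => 0
  | .inl j, some i => a j i
  | .inr p, none => γ p.1 p.2
  | .inr p, some i => if i = p.1 then β p.1 p.2 else 0

/-- When the product is expanded, `φ` records the summand chosen in each factor. The box sum of the
resulting monomial in `y` splits into one power sum per coordinate, and `none` contributes only
factors 1. -/
theorem sum_prod_affine_eq {ι : Type} [Fintype ι] [DecidableEq ι] {R : Type} [CommRing R]
    {J : Type} [Fintype J] [DecidableEq J] (B : ℕ) (a : J → Option ι → R) :
    ∑ y : ι → Fin (B + 1), ∏ j, ∑ i, a j i * (affineCoord y i : R) =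
      ∑ φ : J → Option ι, (∏ j, a j (φ j)) *
        ∏ i : ι, ∑ b : Fin (B + 1), ((b : ℕ) : R) ^ (Fintype.card {j // φ j = some i}) := by
  have h : ∀ y : ι → Fin (B + 1), ∏ j, ∑ i, a j i * (affineCoord y i : R) =
      ∑ φ : J → Option ι, (∏ j, a j (φ j)) *
        ∏ i : ι, ((y i : ℕ) : R) ^ (Fintype.card {j // φ j = some i}) := by
    intro y
    rw [Finset.prod_univ_sum, Fintype.piFinset_univ]
    refine Finset.sum_congr rfl fun φ _ => ?_
    rw [Finset.prod_mul_distrib]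
    congr 1
    rw [← Finset.prod_fiberwise (s := Finset.univ) (g := φ), Fintype.prod_option]
    have h0 : ∏ j ∈ Finset.univ.filter (fun j => φ j = none), (affineCoord y (φ j) : R) = 1 := by
      refine Finset.prod_eq_one fun j hj => ?_
      rw [(Finset.mem_filter.1 hj).2]; simp [affineCoord]
    rw [h0, one_mul]
    refine Finset.prod_congr rfl fun i _ => ?_
    rw [Fintype.card_subtype, ← Finset.prod_const]
    refine Finset.prod_congr rfl fun j hj => ?_
    rw [(Finset.mem_filter.1 hj).2]; simp [affineCoord]
  rw [Finset.sum_congr rfl fun y _ => h y, Finset.sum_comm]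
  refine Finset.sum_congr rfl fun φ _ => ?_
  rw [← Finset.mul_sum, Finset.prod_univ_sum, Fintype.piFinset_univ]

/-- Every sum over a box of integer points of a product of affine forms is a permanent. -/
theorem exists_permanent_eq_sum_prod_affine {ι : Type} [Fintype ι] [DecidableEq ι] {R : Type}
    [CommRing R] [Algebra ℂ R] (B M : ℕ) (a : Fin (M + 1) → Option ι → R) (c : ℂ) :
    ∃ β γ : Option ι → Fin (M + 1) → ℂ,
      (Matrix.of fun r s => absorbingEntry a (fun i r => algebraMap ℂ R (β i r))
        (fun i r => algebraMap ℂ R (γ i r)) r (columnColour s)).permanent =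
      algebraMap ℂ R c *
        ∑ y : ι → Fin (B + 1), ∏ j, ∑ i, a j i * (affineCoord y i : R) := by
  set N : ℕ := ∏ _k : Option (Option ι), (M + 1).factorial with hN
  have hN0 : (N : ℂ) ≠ 0 := by
    rw [hN, Nat.cast_ne_zero]
    exact Finset.prod_ne_zero_iff.2 fun _ _ => Nat.factorial_ne_zero _
  -- The coefficients wanted from the absorbing rows. The extra coordinate has no power sum, so its
  -- weight is free to carry `c` and to cancel the factorials `N` that come from the repeated
  -- columns.
  let w : Option ι → ℕ → ℂ := fun i k =>
    i.elim (c / N) fun _ => ∑ b : Fin (B + 1), ((b : ℕ) : ℂ) ^ k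
  choose β γ hβγ using fun i =>
    exists_prod_linear_eq_binary_form (A := MvPolynomial (Option (Option ι)) R) M (w i)
  refine ⟨β, γ, ?_⟩
  let α : Option (Option ι) →₀ ℕ := Finsupp.equivFunOnFinite.symm fun _ => M + 1
  have hα : ∀ k, α k = Fintype.card {s // columnColour (ι := ι) (M := M) s = k} := by
    intro k
    rw [Fintype.card_subtype, Finset.card_filter, Fintype.sum_sum_type, Fintype.sum_prod_type]
    cases k with
    | none => simp [α, columnColour]
    | some k => simp [α, columnColour]
  rw [permanent_repeated_columns columnColour _ α hα]
  have hN' : (∏ k, (α k).factorial) = N := by simp [α, hN]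
  rw [hN', Fintype.prod_sum_type, Fintype.prod_prod_type]
  have hinl : (∏ j : Fin (M + 1), ∑ k, MvPolynomial.C (absorbingEntry a
        (fun i r => algebraMap ℂ R (β i r)) (fun i r => algebraMap ℂ R (γ i r)) (Sum.inl j) k) *
        MvPolynomial.X k : MvPolynomial (Option (Option ι)) R) =
      ∑ φ : Fin (M + 1) → Option ι,
        MvPolynomial.monomial (∑ j, Finsupp.single (some (φ j)) 1) (∏ j, a j (φ j)) := by
    simp only [Fintype.sum_option (α := Option ι), absorbingEntry, map_zero, zero_mul, zero_add]
    rw [Finset.prod_univ_sum, Fintype.piFinset_univ]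
    refine Finset.sum_congr rfl fun φ _ => ?_
    rw [MvPolynomial.monomial_sum_prod]
    refine Finset.prod_congr rfl fun r _ => ?_
    rw [MvPolynomial.C_mul_X_eq_monomial]
  have hinr : (∏ i : Option ι, ∏ r : Fin (M + 1), ∑ k, MvPolynomial.C (absorbingEntry a
        (fun i r => algebraMap ℂ R (β i r)) (fun i r => algebraMap ℂ R (γ i r))
          (Sum.inr (i, r)) k) *
        MvPolynomial.X k : MvPolynomial (Option (Option ι)) R) =
      ∑ κ ∈ Fintype.piFinset fun _ : Option ι => Finset.range (M + 1 + 1),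
        MvPolynomial.monomial
          (∑ i, (Finsupp.single (some i) (M + 1 - κ i) + Finsupp.single none (κ i)))
          (∏ i, algebraMap ℂ R (w i (κ i))) := by
    have h1 : ∀ i : Option ι, (∏ r : Fin (M + 1), ∑ k, MvPolynomial.C (absorbingEntry a
        (fun i r => algebraMap ℂ R (β i r)) (fun i r => algebraMap ℂ R (γ i r))
          (Sum.inr (i, r)) k) *
        MvPolynomial.X k : MvPolynomial (Option (Option ι)) R) =
        ∑ k ∈ Finset.range (M + 1 + 1), MvPolynomial.monomial
          (Finsupp.single (some i) (M + 1 - k) + Finsupp.single none k)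
          (algebraMap ℂ R (w i k)) := by
      intro i
      have h2 := hβγ i (MvPolynomial.X (some i)) (MvPolynomial.X none)
      have h3 : ∀ (x : ℂ) (p : MvPolynomial (Option (Option ι)) R),
          x • p = MvPolynomial.C (algebraMap ℂ R x) * p := by
        intro x p
        rw [Algebra.smul_def]; rfl
      simp only [h3] at h2
      convert h2 using 1
      · refine Finset.prod_congr rfl fun r _ => ?_
        rw [Fintype.sum_option, add_comm, Finset.sum_eq_single i]
        · simp [absorbingEntry]
        · intro i' _ hi'
          simp [absorbingEntry, hi']
        · simp
      · refine Finset.sum_congr rfl fun k _ => ?_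
        rw [MvPolynomial.X_pow_eq_monomial, MvPolynomial.X_pow_eq_monomial,
          MvPolynomial.monomial_mul, MvPolynomial.C_mul_monomial]
        simp
    rw [Finset.prod_congr rfl fun i _ => h1 i, Finset.prod_univ_sum]
    refine Finset.sum_congr rfl fun κ _ => ?_
    rw [MvPolynomial.monomial_sum_prod]
  rw [hinl, hinr, Finset.sum_mul_sum, MvPolynomial.coeff_sum, sum_prod_affine_eq]
  rw [Finset.mul_sum, Finset.mul_sum]
  refine Finset.sum_congr rfl fun φ _ => ?_
  let cnt : Option ι → ℕ := fun i => Fintype.card {j // φ j = i}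
  have hcnt : ∀ i, (∑ j, Finsupp.single (some (φ j)) 1 : Option (Option ι) →₀ ℕ) (some i) =
      cnt i := by
    intro i
    rw [Finsupp.finsetSum_apply]
    simp only [cnt]
    rw [Fintype.card_subtype, Finset.card_filter]
    simp only [Finsupp.single_apply, Option.some_inj]
  have hcntsum : ∑ i, cnt i = M + 1 := by
    have := Finset.card_eq_sum_card_fiberwise (s := (Finset.univ : Finset (Fin (M + 1)))) (f := φ)
      (t := Finset.univ) (fun _ _ => Finset.mem_coe.2 (Finset.mem_univ _))
    rw [Finset.card_univ, Fintype.card_fin] at this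
    rw [this]
    exact Finset.sum_congr rfl fun i _ => Fintype.card_subtype _
  have hcntle : ∀ i, cnt i ≤ M + 1 := fun i =>
    hcntsum ▸ Finset.single_le_sum (f := cnt) (fun _ _ => Nat.zero_le _) (Finset.mem_univ i)
  -- If the affine rows use `cnt i` columns of colour `i`, the absorbing rows of that colour have
  -- exactly `M + 1 - cnt i` left and must send `cnt i` rows to the shared columns. These are then
  -- filled exactly, as the `cnt i` add up to `M + 1`.
  have hiff : ∀ κ ∈ Fintype.piFinset fun _ : Option ι => Finset.range (M + 1 + 1),
      ((∑ j, Finsupp.single (some (φ j)) 1 +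
        ∑ i, (Finsupp.single (some i) (M + 1 - κ i) + Finsupp.single none (κ i)) = α) ↔
        κ = cnt) := by
    intro κ hκ
    have hκ' : ∀ i, κ i ≤ M + 1 := fun i =>
      Nat.lt_succ_iff.1 (Finset.mem_range.1 (Fintype.mem_piFinset.1 hκ i))
    have hsome : ∀ i, (∑ j, Finsupp.single (some (φ j)) 1 +
        ∑ i, (Finsupp.single (some i) (M + 1 - κ i) + Finsupp.single none (κ i)) :
          Option (Option ι) →₀ ℕ) (some i) = cnt i + (M + 1 - κ i) := by
      intro i
      rw [Finsupp.add_apply, hcnt, Finsupp.finsetSum_apply]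
      simp only [Finsupp.add_apply, Finsupp.single_apply, Option.some_inj, reduceCtorEq, if_false,
        add_zero, Finset.sum_ite_eq', Finset.mem_univ, if_true]
    have hnone : (∑ j, Finsupp.single (some (φ j)) 1 +
        ∑ i, (Finsupp.single (some i) (M + 1 - κ i) + Finsupp.single none (κ i)) :
          Option (Option ι) →₀ ℕ) none = ∑ i, κ i := by
      rw [Finsupp.add_apply, Finsupp.finsetSum_apply, Finsupp.finsetSum_apply]
      simp
    constructor
    · intro h
      funext i
      have h1 := hsome i
      rw [h] at h1
      have h2 : α (some i) = M + 1 := rfl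
      have := hκ' i
      omega
    · intro h
      ext k
      have h2 : α k = M + 1 := rfl
      rw [h2]
      cases k with
      | none => rw [hnone, h, hcntsum]
      | some i => rw [hsome, h]; have := hcntle i; omega
  simp only [MvPolynomial.monomial_mul, MvPolynomial.coeff_sum, MvPolynomial.coeff_monomial]
  rw [Finset.sum_congr rfl fun κ hκ => if_congr (hiff κ hκ) rfl rfl, Finset.sum_ite_eq' _ cnt,
    if_pos (Fintype.mem_piFinset.2 fun i =>
      Finset.mem_range.2 (Nat.lt_succ_of_le (hcntle i))), Fintype.prod_option]
  have hc : algebraMap ℂ R c = (N : R) * algebraMap ℂ R (w none (cnt none)) := by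
    rw [← map_natCast (algebraMap ℂ R), ← map_mul]
    congr 1
    simp only [w, Option.elim_none]
    field_simp
  have hw : ∀ i, algebraMap ℂ R (w (some i) (cnt (some i))) =
      ∑ b : Fin (B + 1), ((b : ℕ) : R) ^ (Fintype.card {j // φ j = some i}) := by
    intro i
    simp [w, cnt]
  rw [hc, Finset.prod_congr rfl fun i _ => hw i]
  ring

/-! ### Derivations of a polynomial system

A system of polynomial equations `V v = ∑_ρ c ρ * x ^ leafs ρ * ∏_w V w ^ child ρ w`, the sum over
the rules `ρ` with head `v`, determines the coefficients of the `V v` as weighted numbers of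
derivations. A derivation is recorded by the number of times each rule is used. -/

/-- The rules of a system of polynomial equations in unknowns `S` and variables `τ`. -/
structure PolySystem (S τ R : Type) where
  head : R → S
  child : R → S → ℕ
  leafs : R → τ →₀ ℕ
  c : R → ℂ

namespace PolySystem

set_option linter.unusedSectionVars false

variable {S τ R : Type} [Fintype S] [DecidableEq S] [Fintype R] [DecidableEq R]

noncomputable section

/-- How often a rule with head `v` is used. -/
def outCount (P : PolySystem S τ R) (y : R → ℕ) (v : S) : ℕ :=
  ∑ ρ, if P.head ρ = v then y ρ else 0

/-- How often `w` occurs on the right hand side of a rule that is used. -/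
def useCount (P : PolySystem S τ R) (y : R → ℕ) (w : S) : ℕ :=
  ∑ ρ, y ρ * P.child ρ w

/-- How often the variables occur on the right hand sides of the rules that are used. -/
def leafCount (P : PolySystem S τ R) (y : R → ℕ) : τ →₀ ℕ :=
  ∑ ρ, y ρ • P.leafs ρ

/-- `y` uses every rule as often as a derivation of `∏_v V v ^ n v` has to. -/
def IsDerivation (P : PolySystem S τ R) (n : S → ℕ) (y : R → ℕ) : Prop :=
  ∀ v, P.outCount y v = n v + P.useCount y v

/-- The total weight of the derivations that use the rules as often as `y` says. -/
def weight (P : PolySystem S τ R) (y : R → ℕ) : ℂ :=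
  (∏ v, ((P.outCount y v).factorial : ℂ)) * ∏ ρ, (P.c ρ ^ y ρ / ((y ρ).factorial : ℂ))

open Classical in
/-- The derivations of the monomial `μ` from `∏_v V v ^ n v`. -/
def derivations (P : PolySystem S τ R) (n : S → ℕ) (μ : τ →₀ ℕ) : Finset (R → ℕ) :=
  (Fintype.piFinset fun _ => Finset.range (2 * μ.degree + 1)).filter fun y =>
    P.IsDerivation n y ∧ P.leafCount y = μ

/-- The weighted number of derivations of the monomial `μ` from `∏_v V v ^ n v`. -/
def count (P : PolySystem S τ R) (n : S → ℕ) (μ : τ →₀ ℕ) : ℂ :=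
  ∑ y ∈ P.derivations n μ, P.weight y

/-- Every rule contains two unknowns and no variable, or one variable and no unknown. -/
def IsQuadratic (P : PolySystem S τ R) : Prop :=
  ∀ ρ, ∑ w, P.child ρ w + 2 * (P.leafs ρ).degree = 2

variable {P : PolySystem S τ R}

/-- Sum the balance condition over all unknowns and count symbols rule by rule. Consequently no rule
is used more than 2·deg μ times, so the box in `derivations` loses nothing. -/
theorem sum_add_sum_eq_of_isDerivation (hP : P.IsQuadratic) {n : S → ℕ} {y : R → ℕ}
    (h : P.IsDerivation n y) : ∑ ρ, y ρ + ∑ v, n v = 2 * (P.leafCount y).degree := by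
  have h1 : ∑ v, P.outCount y v = ∑ ρ, y ρ := by
    simp only [outCount]
    rw [Finset.sum_comm]
    simp
  have h2 : ∑ v, P.useCount y v = ∑ ρ, y ρ * ∑ w, P.child ρ w := by
    simp only [useCount]
    rw [Finset.sum_comm]
    simp [Finset.mul_sum]
  have h3 : (P.leafCount y).degree = ∑ ρ, y ρ * (P.leafs ρ).degree := by
    simp [leafCount, map_sum]
  have h4 : ∑ ρ, y ρ * (∑ w, P.child ρ w + 2 * (P.leafs ρ).degree) = ∑ ρ, y ρ * 2 :=
    Finset.sum_congr rfl fun ρ _ => by rw [hP ρ]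
  simp only [mul_add, Finset.sum_add_distrib, mul_left_comm _ 2] at h4
  rw [← Finset.mul_sum, ← h3, ← h2, ← Finset.sum_mul] at h4
  have h5 : ∑ v, P.outCount y v = ∑ v, n v + ∑ v, P.useCount y v := by
    rw [← Finset.sum_add_distrib]
    exact Finset.sum_congr rfl fun v _ => h v
  omega

theorem mem_derivations (hP : P.IsQuadratic) {n : S → ℕ} {μ : τ →₀ ℕ} {y : R → ℕ} :
    y ∈ P.derivations n μ ↔ P.IsDerivation n y ∧ P.leafCount y = μ := by
  simp only [derivations, Finset.mem_filter, Fintype.mem_piFinset, Finset.mem_range,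
    and_iff_right_iff_imp]
  rintro ⟨h, rfl⟩ ρ
  have h1 := sum_add_sum_eq_of_isDerivation hP h
  have h2 := Finset.single_le_sum (f := y) (fun _ _ => Nat.zero_le _) (Finset.mem_univ ρ)
  omega

theorem outCount_add_single (y : R → ℕ) (ρ : R) (v : S) :
    P.outCount (y + Pi.single ρ 1) v = P.outCount y v + if P.head ρ = v then 1 else 0 := by
  simp only [outCount, Pi.add_apply]
  have : ∀ ρ', (if P.head ρ' = v then y ρ' + Pi.single (M := fun _ => ℕ) ρ 1 ρ' else 0) =
      (if P.head ρ' = v then y ρ' else 0) + if ρ' = ρ then (if P.head ρ = v then 1 else 0) else 0 := by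
    intro ρ'
    by_cases h : ρ' = ρ
    · subst h; split_ifs <;> simp_all
    · simp [h]
  rw [Finset.sum_congr rfl fun ρ' _ => this ρ', Finset.sum_add_distrib]
  simp

theorem useCount_add_single (y : R → ℕ) (ρ : R) (w : S) :
    P.useCount (y + Pi.single ρ 1) w = P.useCount y w + P.child ρ w := by
  simp only [useCount, Pi.add_apply, add_mul, Finset.sum_add_distrib]
  simp [Pi.single_apply]

theorem leafCount_add_single (y : R → ℕ) (ρ : R) :
    P.leafCount (y + Pi.single ρ 1) = P.leafCount y + P.leafs ρ := by
  simp only [leafCount, Pi.add_apply, add_smul, Finset.sum_add_distrib]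
  simp [Pi.single_apply]

/-- Only two factorials change, the one of `y ρ` and the one at the head of `ρ`, each by a single
factor. -/
theorem weight_add_single (y : R → ℕ) (ρ : R) :
    P.weight (y + Pi.single ρ 1) * (y ρ + 1 : ℕ) =
      P.c ρ * (P.outCount y (P.head ρ) + 1 : ℕ) * P.weight y := by
  have h1 : (∏ v, ((P.outCount (y + Pi.single ρ 1) v).factorial : ℂ)) =
      (P.outCount y (P.head ρ) + 1 : ℕ) * ∏ v, ((P.outCount y v).factorial : ℂ) := by
    rw [← Finset.mul_prod_erase _ _ (Finset.mem_univ (P.head ρ)),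
      ← Finset.mul_prod_erase _ (fun v => ((P.outCount y v).factorial : ℂ))
        (Finset.mem_univ (P.head ρ)), outCount_add_single, if_pos rfl, Nat.factorial_succ,
      Nat.cast_mul, mul_assoc]
    congr 2
    refine Finset.prod_congr rfl fun v hv => ?_
    rw [outCount_add_single, if_neg (Finset.ne_of_mem_erase hv).symm, add_zero]
  have h2 : (∏ ρ', (P.c ρ' ^ (y + Pi.single ρ 1 : R → ℕ) ρ' / (((y + Pi.single ρ 1 : R → ℕ) ρ').factorial : ℂ))) *
      (y ρ + 1 : ℕ) = P.c ρ * ∏ ρ', (P.c ρ' ^ y ρ' / ((y ρ').factorial : ℂ)) := by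
    rw [← Finset.mul_prod_erase _ _ (Finset.mem_univ ρ),
      ← Finset.mul_prod_erase _ (fun ρ' => P.c ρ' ^ y ρ' / ((y ρ').factorial : ℂ))
        (Finset.mem_univ ρ)]
    have h3 : ∏ ρ' ∈ Finset.univ.erase ρ,
        (P.c ρ' ^ (y + Pi.single ρ 1 : R → ℕ) ρ' / (((y + Pi.single ρ 1 : R → ℕ) ρ').factorial : ℂ)) =
        ∏ ρ' ∈ Finset.univ.erase ρ, (P.c ρ' ^ y ρ' / ((y ρ').factorial : ℂ)) := by
      refine Finset.prod_congr rfl fun ρ' hρ' => ?_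
      simp [Finset.ne_of_mem_erase hρ']
    rw [h3]
    simp only [Pi.add_apply, Pi.single_eq_same, Nat.factorial_succ, pow_succ, Nat.cast_mul]
    have h4 : ((y ρ + 1 : ℕ) : ℂ) ≠ 0 := Nat.cast_ne_zero.2 (Nat.succ_ne_zero _)
    have h5 : ((y ρ).factorial : ℂ) ≠ 0 := Nat.cast_ne_zero.2 (Nat.factorial_ne_zero _)
    field_simp
  simp only [weight]
  rw [h1, mul_assoc, h2]
  ring

theorem isDerivation_add_single {n : S → ℕ} {y : R → ℕ} {ρ : R} :
    P.IsDerivation (n + Pi.single (P.head ρ) 1) (y + Pi.single ρ 1) ↔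
      P.IsDerivation (n + P.child ρ) y := by
  refine forall_congr' fun v => ?_
  rw [outCount_add_single, useCount_add_single]
  simp only [Pi.add_apply, Pi.single_apply, eq_comm (a := v)]
  split_ifs <;> omega

/-- Derivations are counted by the first rule that is applied to a given unknown. -/
theorem count_add_single (hP : P.IsQuadratic) (n : S → ℕ) (v : S) (μ : τ →₀ ℕ) [DecidableEq τ] :
    P.count (n + Pi.single v 1) μ =
      ∑ ρ, if P.head ρ = v then
        if P.leafs ρ ≤ μ then P.c ρ * P.count (n + P.child ρ) (μ - P.leafs ρ) else 0 else 0 := by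
  -- The weight of `y` is shared among the rules with head `v` in proportion to their
  -- multiplicities.
  have hsplit : ∀ y ∈ P.derivations (n + Pi.single v 1) μ, P.weight y =
      ∑ ρ, if P.head ρ = v then (y ρ : ℂ) / P.outCount y v * P.weight y else 0 := by
    intro y hy
    have hout : P.outCount y v ≠ 0 := by
      have := ((mem_derivations hP).1 hy).1 v
      simp only [Pi.add_apply, Pi.single_eq_same] at this
      omega
    have h1 : ∑ ρ, (if P.head ρ = v then (y ρ : ℂ) / P.outCount y v * P.weight y else 0) =
        (∑ ρ, if P.head ρ = v then (y ρ : ℂ) else 0) / P.outCount y v * P.weight y := by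
      rw [Finset.sum_div, Finset.sum_mul]
      refine Finset.sum_congr rfl fun ρ _ => ?_
      split_ifs <;> simp
    have h2 : (∑ ρ, if P.head ρ = v then (y ρ : ℂ) else 0) = P.outCount y v := by
      rw [outCount]; push_cast; rfl
    rw [h1, h2, div_self (Nat.cast_ne_zero.2 hout), one_mul]
  rw [count, Finset.sum_congr rfl hsplit, Finset.sum_comm]
  refine Finset.sum_congr rfl fun ρ _ => ?_
  split_ifs with hv hle
  · subst hv
    rw [count, Finset.mul_sum]
    symm
    -- Adding one use of `ρ` misses only those `y` with `y ρ = 0`, whose share is zero.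
    refine Finset.sum_of_injOn (fun y => y + Pi.single ρ 1) ?_ ?_ ?_ ?_
    · intro y _ y' _ h
      exact add_right_cancel h
    · intro y hy
      rw [Finset.mem_coe, mem_derivations hP] at hy ⊢
      refine ⟨isDerivation_add_single.2 hy.1, ?_⟩
      rw [leafCount_add_single, hy.2, tsub_add_cancel_of_le hle]
    · intro y hy hny
      have hy0 : y ρ = 0 := by
        by_contra h0
        apply hny
        have hyy : (y - Pi.single ρ 1) + Pi.single ρ 1 = y := by
          apply tsub_add_cancel_of_le
          intro ρ'
          by_cases h : ρ' = ρ
          · subst h; simp; omega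
          · simp [h]
        refine ⟨y - Pi.single ρ 1, ?_, hyy⟩
        rw [Finset.mem_coe, mem_derivations hP]
        rw [mem_derivations hP, ← hyy, isDerivation_add_single, leafCount_add_single] at hy
        refine ⟨hy.1, ?_⟩
        rw [← hy.2, add_tsub_cancel_right]
      simp [hy0]
    · intro y hy
      have h1 := P.weight_add_single y ρ
      have h3 : ((P.outCount y (P.head ρ) + 1 : ℕ) : ℂ) ≠ 0 :=
        Nat.cast_ne_zero.2 (Nat.succ_ne_zero _)
      rw [outCount_add_single, if_pos rfl]
      simp only [Pi.add_apply, Pi.single_eq_same]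
      field_simp
      rw [mul_comm ((y ρ + 1 : ℕ) : ℂ), h1]
      ring
  · refine Finset.sum_eq_zero fun y hy => ?_
    have hy0 : y ρ = 0 := by
      by_contra h0
      apply hle
      rw [← ((mem_derivations hP).1 hy).2, leafCount]
      calc P.leafs ρ ≤ y ρ • P.leafs ρ := by
            conv_lhs => rw [← one_smul ℕ (P.leafs ρ)]
            exact smul_le_smul_of_nonneg_right (Nat.one_le_iff_ne_zero.2 h0) (zero_le)
        _ ≤ _ := Finset.single_le_sum (f := fun ρ => y ρ • P.leafs ρ) (fun _ _ => zero_le)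
            (Finset.mem_univ ρ)
    simp [hy0]
  · simp

/-! ### Triangular systems and the coefficients of their solutions -/

/-- In a rule with nonzero coefficient the unknowns on the right are smaller than the head. -/
def IsTriangular (P : PolySystem S τ R) (rank : S → ℕ) : Prop :=
  ∀ ρ, P.c ρ ≠ 0 → ∀ w, P.child ρ w ≠ 0 → rank w < rank (P.head ρ)

/-- By the balance condition, the head of a used rule of maximal rank occurs on the right of another
used rule, whose head has larger rank. This excludes closed cycles of rules, which balance without
deriving anything. -/
theorem eq_zero_of_isDerivation_zero {rank : S → ℕ} (hT : P.IsTriangular rank) {y : R → ℕ}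
    (h : P.IsDerivation 0 y) (hw : P.weight y ≠ 0) : y = 0 := by
  by_contra hy
  have hne : (Finset.univ.filter fun ρ => y ρ ≠ 0).Nonempty := by
    obtain ⟨ρ, hρ⟩ := Function.ne_iff.1 hy
    exact ⟨ρ, by simpa using hρ⟩
  obtain ⟨ρ, hρ, hmax⟩ := Finset.exists_max_image _ (fun ρ => rank (P.head ρ)) hne
  have hρ' : y ρ ≠ 0 := (Finset.mem_filter.1 hρ).2
  have hout : P.outCount y (P.head ρ) ≠ 0 := by
    intro h0
    rw [outCount, Finset.sum_eq_zero_iff] at h0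
    exact hρ' (by simpa using h0 ρ (Finset.mem_univ ρ))
  rw [h, Pi.zero_apply, zero_add, useCount] at hout
  obtain ⟨ρ', -, h'⟩ := Finset.exists_ne_zero_of_sum_ne_zero hout
  have hy' : y ρ' ≠ 0 := left_ne_zero_of_mul h'
  have hc : P.c ρ' ≠ 0 := by
    intro h0
    apply hw
    rw [weight, Finset.prod_eq_zero (i := ρ') (Finset.mem_univ _), mul_zero]
    simp [h0, hy']
  have h1 := hT ρ' hc _ (right_ne_zero_of_mul h')
  have h2 := hmax ρ' (by simpa using hy')
  omega

theorem weight_zero : P.weight 0 = 1 := by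
  simp [weight, outCount]

theorem isDerivation_zero : P.IsDerivation 0 0 := by
  intro v
  simp [outCount, useCount]

theorem leafCount_zero : P.leafCount 0 = 0 := by
  simp [leafCount]

theorem count_zero (hP : P.IsQuadratic) {rank : S → ℕ} (hT : P.IsTriangular rank)
    (μ : τ →₀ ℕ) [Decidable (0 = μ)] : P.count 0 μ = if 0 = μ then 1 else 0 := by
  split_ifs with h
  · subst h
    rw [count, Finset.sum_eq_single 0, weight_zero]
    · intro y hy hy0
      by_contra hw
      exact hy0 (eq_zero_of_isDerivation_zero hT ((mem_derivations hP).1 hy).1 hw)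
    · intro h0
      exact absurd ((mem_derivations hP).2 ⟨isDerivation_zero, leafCount_zero⟩) h0
  · refine Finset.sum_eq_zero fun y hy => ?_
    by_contra hw
    obtain ⟨h1, h2⟩ := (mem_derivations hP).1 hy
    rw [eq_zero_of_isDerivation_zero hT h1 hw, leafCount_zero] at h2
    exact h h2

theorem prod_mem_idealOfVars_pow {V : S → MvPolynomial τ ℂ}
    (hV : ∀ v, V v ∈ MvPolynomial.idealOfVars τ ℂ) (n : S → ℕ) :
    ∏ v, V v ^ n v ∈ MvPolynomial.idealOfVars τ ℂ ^ ∑ v, n v := by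
  rw [← Finset.prod_pow_eq_pow_sum]
  exact Ideal.prod_mem_prod fun v _ => Ideal.pow_mem_pow (hV v) _

/-- The coefficients of a solution of the system are weighted numbers of derivations. -/
theorem coeff_prod_pow_eq_count (hP : P.IsQuadratic) {rank : S → ℕ} (hT : P.IsTriangular rank)
    {V : S → MvPolynomial τ ℂ} (hV0 : ∀ v, V v ∈ MvPolynomial.idealOfVars τ ℂ)
    (hV : ∀ v, V v = ∑ ρ, if P.head ρ = v then
      MvPolynomial.monomial (P.leafs ρ) (P.c ρ) * ∏ w, V w ^ P.child ρ w else 0)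
    (n : S → ℕ) (μ : τ →₀ ℕ) : MvPolynomial.coeff μ (∏ v, V v ^ n v) = P.count n μ := by
  classical
  by_cases hn : n = 0
  · subst hn
    simp [count_zero hP hT, MvPolynomial.coeff_one]
  -- The `V v` have no constant terms, so both sides vanish in this range.
  by_cases hlt : μ.degree < ∑ v, n v
  · rw [(MvPolynomial.mem_pow_idealOfVars_iff' _ _).1 (prod_mem_idealOfVars_pow hV0 n) μ hlt,
      count, Finset.sum_eq_zero]
    intro y hy
    obtain ⟨h1, h2⟩ := (mem_derivations hP).1 hy
    have h3 := sum_add_sum_eq_of_isDerivation hP h1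
    have h4 : ∑ v, P.outCount y v = ∑ ρ, y ρ := by
      simp only [outCount]
      rw [Finset.sum_comm]
      simp
    have h5 : ∑ v, P.outCount y v = ∑ v, n v + ∑ v, P.useCount y v := by
      rw [← Finset.sum_add_distrib]
      exact Finset.sum_congr rfl fun v _ => h1 v
    rw [h2] at h3
    omega
  -- One factor `V v` is replaced by its equation, matching the recursion `count_add_single`.
  obtain ⟨v, hv⟩ := Function.ne_iff.1 hn
  obtain ⟨m, hm⟩ : ∃ m, n = m + Pi.single v 1 := by
    refine ⟨n - Pi.single v 1, (tsub_add_cancel_of_le ?_).symm⟩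
    intro w
    by_cases h : w = v
    · subst h; simp at hv ⊢; omega
    · simp [h]
  rw [hm, count_add_single hP]
  have hprod : ∏ w, V w ^ (m + Pi.single v 1 : S → ℕ) w = V v * ∏ w, V w ^ m w := by
    simp only [Pi.add_apply, pow_add, Finset.prod_mul_distrib]
    rw [mul_comm]
    congr 1
    rw [Finset.prod_eq_single v] <;> simp +contextual
  rw [hprod, hV v, Finset.sum_mul, MvPolynomial.coeff_sum]
  refine Finset.sum_congr rfl fun ρ _ => ?_
  split_ifs with hρ hle
  · have hcomb : MvPolynomial.monomial (P.leafs ρ) (P.c ρ) * (∏ w, V w ^ P.child ρ w) *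
        ∏ w, V w ^ m w = MvPolynomial.monomial (P.leafs ρ) (P.c ρ) *
          ∏ w, V w ^ (m + P.child ρ) w := by
      simp only [Pi.add_apply, pow_add, Finset.prod_mul_distrib]
      ring
    rw [hcomb, MvPolynomial.coeff_monomial_mul', if_pos hle,
      coeff_prod_pow_eq_count hP hT hV0 hV (m + P.child ρ) (μ - P.leafs ρ)]
  · rw [mul_assoc, MvPolynomial.coeff_monomial_mul', if_neg hle]
  · simp
-- A rule with two unknowns raises ∑ n by one; a rule with a variable lowers both ∑ n and the degree
-- by one. Either way the measure drops by one.
termination_by 2 * μ.degree - ∑ v, n v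
decreasing_by
  have h1 := hP ρ
  have h2 : μ.degree = (μ - P.leafs ρ).degree + (P.leafs ρ).degree := by
    rw [← map_add, tsub_add_cancel_of_le hle]
  have h3 : ∑ w, n w = ∑ w, m w + 1 := by
    simp [hm, Finset.sum_add_distrib]
  have h4 : ∑ w, (m + P.child ρ) w = ∑ w, m w + ∑ w, P.child ρ w := by
    simp [Finset.sum_add_distrib]
  omega

end

end PolySystem

/-! ### The polynomial system of a circuit -/

noncomputable section

namespace ArithCircuit

/-- The polynomials computed by a circuit, without their constant terms. -/
def reducedValue {τ : Type} {s : ℕ} (Γ : ArithCircuit ℂ τ s) (v : Fin s) : MvPolynomial τ ℂ :=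
  Γ.value v - MvPolynomial.C (MvPolynomial.constantCoeff (Γ.value v))

theorem value_snoc_castSucc {F τ : Type} [CommSemiring F] {s : ℕ} (Γ : ArithCircuit F τ s)
    (g : ArithGate F τ s) (v : Fin s) : (Γ.snoc g).value v.castSucc = Γ.value v := by
  simp [value]

theorem value_snoc_last {F τ : Type} [CommSemiring F] {s : ℕ} (Γ : ArithCircuit F τ s)
    (g : ArithGate F τ s) : (Γ.snoc g).value (Fin.last s) = g.value Γ.value := by
  simp [value]

theorem reducedValue_snoc_castSucc {τ : Type} {s : ℕ} (Γ : ArithCircuit ℂ τ s)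
    (g : ArithGate ℂ τ s) (v : Fin s) :
    (Γ.snoc g).reducedValue v.castSucc = Γ.reducedValue v := by
  rw [reducedValue, value_snoc_castSucc, reducedValue]

/-- The variables, and the products of two reduced values of gates before `v`. -/
def reducedTerms {τ : Type} {s : ℕ} (Γ : ArithCircuit ℂ τ s) (v : Fin s) :
    Set (MvPolynomial τ ℂ) :=
  Set.range MvPolynomial.X ∪ {p | ∃ a b, a < v ∧ b < v ∧ p = Γ.reducedValue a * Γ.reducedValue b}

theorem reducedTerms_subset_snoc {τ : Type} {s : ℕ} (Γ : ArithCircuit ℂ τ s)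
    (g : ArithGate ℂ τ s) {v : Fin s} {v' : Fin (s + 1)} (hv : v.castSucc ≤ v') :
    Γ.reducedTerms v ⊆ (Γ.snoc g).reducedTerms v' := by
  refine Set.union_subset_union_right _ ?_
  rintro p ⟨a, b, ha, hb, rfl⟩
  refine ⟨a.castSucc, b.castSucc, lt_of_lt_of_le (Fin.castSucc_lt_castSucc_iff.2 ha) hv,
    lt_of_lt_of_le (Fin.castSucc_lt_castSucc_iff.2 hb) hv, ?_⟩
  rw [reducedValue_snoc_castSucc, reducedValue_snoc_castSucc]

/-- Since (a + α)(b + β) - αβ = ab + αb + βa, a product gate adds one quadratic term to combinations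
of earlier reduced values. Linear occurrences of earlier gates are always expanded by induction, so
no linear rules remain and the system is quadratic. -/
theorem reducedValue_mem_span {τ : Type} {s : ℕ} (Γ : ArithCircuit ℂ τ s) (v : Fin s) :
    Γ.reducedValue v ∈ Submodule.span ℂ (Γ.reducedTerms v) := by
  induction Γ with
  | nil => exact v.elim0
  | @snoc s Γ g ih =>
    have ih' : ∀ (a : Fin s) (v' : Fin (s + 1)), a.castSucc ≤ v' →
        Γ.reducedValue a ∈ Submodule.span ℂ ((Γ.snoc g).reducedTerms v') := fun a v' h =>
      Submodule.span_mono (Γ.reducedTerms_subset_snoc g h) (ih a)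
    refine Fin.lastCases ?_ (fun v => ?_) v
    · have hlast : ∀ a : Fin s, a.castSucc ≤ Fin.last s := fun a => Fin.le_last _
      rw [reducedValue, value_snoc_last]
      cases g with
      | var x =>
        refine Submodule.subset_span (Or.inl ⟨x, ?_⟩)
        simp [ArithGate.value]
      | const c => simp [ArithGate.value]
      | add i j =>
        convert Submodule.add_mem _ (ih' i _ (hlast i)) (ih' j _ (hlast j)) using 1
        simp only [ArithGate.value, reducedValue, map_add]
        ring
      | mul i j =>
        have hij : Γ.reducedValue i * Γ.reducedValue j ∈
            Submodule.span ℂ ((Γ.snoc (.mul i j)).reducedTerms (Fin.last s)) := by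
          refine Submodule.subset_span (Or.inr ⟨i.castSucc, j.castSucc, Fin.castSucc_lt_last i,
            Fin.castSucc_lt_last j, ?_⟩)
          rw [reducedValue_snoc_castSucc, reducedValue_snoc_castSucc]
        convert Submodule.add_mem _ hij (Submodule.add_mem _
          (Submodule.smul_mem _ (MvPolynomial.constantCoeff (Γ.value i)) (ih' j _ (hlast j)))
          (Submodule.smul_mem _ (MvPolynomial.constantCoeff (Γ.value j)) (ih' i _ (hlast i)))) using 1
        simp only [ArithGate.value, reducedValue, map_mul, MvPolynomial.smul_eq_C_mul]
        ring
    · rw [reducedValue_snoc_castSucc]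
      exact ih' v _ le_rfl

/-- The rules of the polynomial system with the given coefficients. -/
def polySystem {τ : Type} {s : ℕ} (c : Fin s → τ ⊕ (Fin s × Fin s) → ℂ) :
    PolySystem (Fin s) τ (Fin s × (τ ⊕ (Fin s × Fin s))) where
  head := Prod.fst
  child ρ := Sum.elim (fun _ => 0) (fun p => Pi.single p.1 1 + Pi.single p.2 1) ρ.2
  leafs ρ := Sum.elim (fun x => Finsupp.single x 1) (fun _ => 0) ρ.2
  c ρ := Sum.elim (fun x => c ρ.1 (Sum.inl x))
    (fun p => if p.1 < ρ.1 ∧ p.2 < ρ.1 then c ρ.1 (Sum.inr p) else 0) ρ.2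

/-- The reduced values of a circuit solve a triangular quadratic system. -/
theorem exists_polySystem {τ : Type} [Fintype τ] {s : ℕ} (Γ : ArithCircuit ℂ τ s) :
    ∃ P : PolySystem (Fin s) τ (Fin s × (τ ⊕ (Fin s × Fin s))),
      P.IsQuadratic ∧ P.IsTriangular (fun v => (v : ℕ)) ∧
      ∀ v, Γ.reducedValue v = ∑ ρ, if P.head ρ = v then
        MvPolynomial.monomial (P.leafs ρ) (P.c ρ) * ∏ w, Γ.reducedValue w ^ P.child ρ w else 0 := by
  have h : ∀ v, ∃ c : τ ⊕ (Fin s × Fin s) → ℂ, ∑ t, c t • Sum.elim MvPolynomial.X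
      (fun p : Fin s × Fin s => if p.1 < v ∧ p.2 < v then
        Γ.reducedValue p.1 * Γ.reducedValue p.2 else 0) t = Γ.reducedValue v := by
    intro v
    rw [← Submodule.mem_span_range_iff_exists_fun]
    refine Submodule.span_mono ?_ (Γ.reducedValue_mem_span v)
    rintro p (⟨x, rfl⟩ | ⟨a, b, ha, hb, rfl⟩)
    · exact ⟨Sum.inl x, rfl⟩
    · exact ⟨Sum.inr (a, b), by simp [ha, hb]⟩
  choose c hc using h
  refine ⟨polySystem c, ?_, ?_, ?_⟩
  · rintro ⟨v, x | p⟩ <;> simp [polySystem, Finset.sum_add_distrib]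
  · rintro ⟨v, x | p⟩ hρ w hw
    · simp [polySystem] at hw
    · simp only [polySystem, Sum.elim_inr, ne_eq, ite_eq_right_iff, not_forall] at hρ
      obtain ⟨⟨h1, h2⟩, -⟩ := hρ
      simp only [polySystem, Sum.elim_inr, Pi.add_apply, Pi.single_apply] at hw
      by_cases hw1 : w = p.1
      · subst hw1; exact h1
      · by_cases hw2 : w = p.2
        · subst hw2; exact h2
        · simp [hw1, hw2] at hw
  · intro v
    rw [Fintype.sum_prod_type, Finset.sum_eq_single v, ← hc v]
    · refine Finset.sum_congr rfl fun t _ => ?_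
      rcases t with x | p
      · simp [polySystem, MvPolynomial.smul_eq_C_mul, MvPolynomial.C_mul_X_eq_monomial]
      · simp only [polySystem, Sum.elim_inr, if_true, Pi.add_apply, pow_add,
          Finset.prod_mul_distrib, MvPolynomial.smul_eq_C_mul]
        have hs : ∀ a : Fin s, ∏ w, Γ.reducedValue w ^ (Pi.single a 1 : Fin s → ℕ) w =
            Γ.reducedValue a := by
          intro a
          rw [Finset.prod_eq_single a] <;> simp +contextual
        rw [hs, hs]
        split_ifs <;> simp
    · intro v' _ hv'
      refine Finset.sum_eq_zero fun t _ => ?_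
      simp [polySystem, hv']
    · simp

theorem reducedValue_mem_idealOfVars {τ : Type} {s : ℕ} (Γ : ArithCircuit ℂ τ s) (v : Fin s) :
    Γ.reducedValue v ∈ MvPolynomial.idealOfVars τ ℂ := by
  rw [← pow_one (MvPolynomial.idealOfVars τ ℂ), MvPolynomial.mem_pow_idealOfVars_iff']
  intro x hx
  have hx0 : x = 0 := by
    rw [← Finsupp.degree_eq_zero_iff]; omega
  subst hx0
  simp [reducedValue, MvPolynomial.constantCoeff_eq]

end ArithCircuit

end

/-! ### Products of affine forms on a box -/

noncomputable section

/-- The polynomial that is a variable or a constant. -/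
def symbolPoly {σ : Type} (x : σ ⊕ ℂ) : MvPolynomial σ ℂ :=
  Sum.elim (fun x => MvPolynomial.X x) (fun c => MvPolynomial.C c) x

/-- The value at an integer point of an affine form, each of whose coefficients is a variable or a
constant. -/
def affineValue {σ ι : Type} [Fintype ι] {B : ℕ} (a : Option ι → σ ⊕ ℂ) (y : ι → Fin (B + 1)) :
    MvPolynomial σ ℂ :=
  ∑ i, symbolPoly (a i) * (affineCoord y i : MvPolynomial σ ℂ)

/-- On the box `{0, …, B}^ι`, `f` is a product of at most `N` affine forms whose coefficients are
variables and constants. -/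
def IsAffineProd {σ ι : Type} [Fintype ι] {B : ℕ} (f : (ι → Fin (B + 1)) → MvPolynomial σ ℂ)
    (N : ℕ) : Prop :=
  ∃ l : List (Option ι → σ ⊕ ℂ), l.length ≤ N ∧
    ∀ y, f y = (l.map fun a => affineValue a y).prod

namespace IsAffineProd

variable {σ ι : Type} [Fintype ι] {B : ℕ}

theorem one : IsAffineProd (fun _ : ι → Fin (B + 1) => (1 : MvPolynomial σ ℂ)) 0 :=
  ⟨[], le_rfl, fun _ => rfl⟩

theorem mul {f g : (ι → Fin (B + 1)) → MvPolynomial σ ℂ} {N N' : ℕ} (hf : IsAffineProd f N)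
    (hg : IsAffineProd g N') : IsAffineProd (fun y => f y * g y) (N + N') := by
  obtain ⟨l, hl, hf⟩ := hf
  obtain ⟨l', hl', hg⟩ := hg
  refine ⟨l ++ l', by rw [List.length_append]; omega, fun y => ?_⟩
  simp only [List.map_append, List.prod_append, hf, hg]

theorem finsetProd {J : Type} (s : Finset J) {f : J → (ι → Fin (B + 1)) → MvPolynomial σ ℂ} {N : ℕ}
    (hf : ∀ j, IsAffineProd (f j) N) : IsAffineProd (fun y => ∏ j ∈ s, f j y) (s.card * N) := by
  classical
  induction s using Finset.induction_on with
  | empty => simpa using one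
  | insert j s hj ih =>
    simp only [Finset.prod_insert hj, Finset.card_insert_of_notMem hj]
    rw [add_mul, one_mul, add_comm (s.card * N)]
    exact (hf j).mul ih

theorem prod {J : Type} [Fintype J] {f : J → (ι → Fin (B + 1)) → MvPolynomial σ ℂ} {N : ℕ}
    (hf : ∀ j, IsAffineProd (f j) N) :
    IsAffineProd (fun y => ∏ j, f j y) (Fintype.card J * N) :=
  finsetProd Finset.univ hf

/-- A function of an integer linear form with small coefficients is a product of affine forms. -/
theorem ofLinear (Φ : ℤ → ℂ) (k : ι → ℤ) (hk : ∀ i, |k i| ≤ 2) :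
    IsAffineProd (fun y : ι → Fin (B + 1) =>
      (MvPolynomial.C (Φ (∑ i, k i * ((y i : ℕ) : ℤ))) : MvPolynomial σ ℂ))
      (4 * B * Fintype.card ι + 2) := by
  -- On the box the linear form takes values in [-H, H]; interpolation at these 2H + 1 nodes has
  -- degree at most 2H = 4·B·|ι|.
  set H : ℤ := 2 * B * Fintype.card ι with hH
  have hH0 : 0 ≤ H := by positivity
  have hinj : Set.InjOn (fun t : ℤ => (t : ℂ)) (Finset.Icc (-H) H : Finset ℤ) :=
    Int.cast_injective.injOn
  set p := Lagrange.interpolate (Finset.Icc (-H) H) (fun t : ℤ => (t : ℂ)) Φ with hp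
  have hdeg : p.natDegree ≤ 4 * B * Fintype.card ι := by
    have h1 := Lagrange.degree_interpolate_lt Φ hinj
    rw [← hp] at h1
    by_cases hp0 : p = 0
    · simp [hp0]
    · rw [← Polynomial.natDegree_lt_iff_degree_lt hp0, Int.card_Icc] at h1
      have h2 : (H + 1 - -H).toNat = 4 * B * Fintype.card ι + 1 := by
        have h3 : H + 1 - -H = ((4 * B * Fintype.card ι + 1 : ℕ) : ℤ) := by
          push_cast
          rw [hH]; ring
        rw [h3, Int.toNat_natCast]
      omega
  have hsplit := (IsAlgClosed.splits p).eq_prod_roots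
  -- The affine forms are the leading coefficient, as a constant form, and the linear form minus
  -- each root.
  refine ⟨(fun i => i.elim (Sum.inr p.leadingCoeff) fun _ => Sum.inr 0) ::
    p.roots.toList.map (fun x i => i.elim (Sum.inr (-x)) fun i => Sum.inr (k i : ℂ)), ?_, ?_⟩
  · rw [List.length_cons, List.length_map, Multiset.length_toList]
    have := p.card_roots'
    omega
  · intro y
    have hmem : (∑ i, k i * ((y i : ℕ) : ℤ)) ∈ Finset.Icc (-H) H := by
      rw [Finset.mem_Icc, ← abs_le]
      calc |∑ i, k i * ((y i : ℕ) : ℤ)| ≤ ∑ i, |k i * ((y i : ℕ) : ℤ)| :=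
            Finset.abs_sum_le_sum_abs _ _
        _ ≤ ∑ _i : ι, (2 * B : ℤ) := by
            refine Finset.sum_le_sum fun i _ => ?_
            rw [abs_mul, Nat.abs_cast]
            have h3 : ((y i : ℕ) : ℤ) ≤ B := by exact_mod_cast Nat.lt_succ_iff.1 (y i).2
            exact mul_le_mul (hk i) h3 (by positivity) (by norm_num)
        _ = H := by simp [hH]; ring
    beta_reduce
    rw [← Lagrange.eval_interpolate_at_node Φ hinj hmem, ← hp]
    have hev : p.eval ((∑ i, k i * ((y i : ℕ) : ℤ) : ℤ) : ℂ) = p.leadingCoeff *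
        (p.roots.toList.map fun x => ((∑ i, k i * ((y i : ℕ) : ℤ) : ℤ) : ℂ) - x).prod := by
      conv_lhs => rw [hsplit]
      rw [Polynomial.eval_mul, Polynomial.eval_C, Polynomial.eval_multiset_prod,
        Multiset.map_map, Multiset.prod_map_toList]
      simp
    rw [hev, map_mul, map_list_prod, List.map_cons, List.prod_cons, List.map_map, List.map_map]
    congr 1
    · simp [affineValue, affineCoord, symbolPoly, Fintype.sum_option]
    · congr 1
      refine List.map_congr_left fun x _ => ?_
      simp [affineValue, affineCoord, symbolPoly, Fintype.sum_option]
      ring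

theorem ofLinear' {f : (ι → Fin (B + 1)) → MvPolynomial σ ℂ} (Φ : ℤ → ℂ) (k : ι → ℤ)
    (hk : ∀ i, |k i| ≤ 2) (hf : ∀ y, f y = MvPolynomial.C (Φ (∑ i, k i * ((y i : ℕ) : ℤ)))) :
    IsAffineProd f (4 * B * Fintype.card ι + 2) := by
  rw [funext hf]
  exact ofLinear Φ k hk

/-- These forms bring in the variables of the polynomial. The coordinates have to differ, since a
coefficient X + 1 is neither a variable nor a constant. -/
theorem X_mul_add (x : σ) {i j : ι} (hij : i ≠ j) :
    IsAffineProd (fun y : ι → Fin (B + 1) =>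
      MvPolynomial.X x * ((y i : ℕ) : MvPolynomial σ ℂ) + ((y j : ℕ) : MvPolynomial σ ℂ)) 1 := by
  classical
  refine ⟨[fun t => t.elim (Sum.inr 0) fun t => if t = i then Sum.inl x else
    if t = j then Sum.inr 1 else Sum.inr 0], le_rfl, fun y => ?_⟩
  simp only [affineValue, affineCoord, Fintype.sum_option, List.map_cons, List.map_nil,
    List.prod_cons, List.prod_nil, mul_one, Option.elim_none, Option.elim_some]
  rw [Finset.sum_eq_add i j hij]
  · simp [symbolPoly, hij.symm]
  · intro t _ ht
    simp [symbolPoly, ht.1, ht.2]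
  · simp
  · simp

/-- Sums of products of affine forms are permanents. -/
theorem exists_permanent [DecidableEq ι] {f : (ι → Fin (B + 1)) → MvPolynomial σ ℂ} {N : ℕ}
    (hf : IsAffineProd f N) :
    ∃ d ≤ (N + 1) * (Fintype.card ι + 2), ∀ c : ℂ, ∃ A : Fin d → Fin d → σ ⊕ ℂ,
      (Matrix.of fun i j => symbolPoly (A i j)).permanent = MvPolynomial.C c * ∑ y, f y := by
  classical
  obtain ⟨l, hl, hf⟩ := hf
  let κ : Type := Fin (l.length + 1) ⊕ (Option ι × Fin (l.length + 1))
  refine ⟨Fintype.card κ, ?_, fun c => ?_⟩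
  · simp only [κ, Fintype.card_sum, Fintype.card_prod, Fintype.card_option, Fintype.card_fin]
    calc l.length + 1 + (Fintype.card ι + 1) * (l.length + 1) =
        (l.length + 1) * (Fintype.card ι + 2) := by ring
      _ ≤ _ := Nat.mul_le_mul_right _ (by omega)
  -- A form equal to 1 is prepended because the number of forms must be positive for the binary
  -- forms to factor.
  let l' : List (Option ι → σ ⊕ ℂ) := (fun i => i.elim (Sum.inr 1) fun _ => Sum.inr 0) :: l
  obtain ⟨β, γ, h⟩ := exists_permanent_eq_sum_prod_affine (R := MvPolynomial σ ℂ) B l.length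
    (fun j i => symbolPoly (l'.get j i)) c
  have hA : ∀ r s : κ, ∃ x : σ ⊕ ℂ, symbolPoly x =
      absorbingEntry (fun j i => symbolPoly (l'.get j i))
        (fun i r => algebraMap ℂ (MvPolynomial σ ℂ) (β i r))
        (fun i r => algebraMap ℂ (MvPolynomial σ ℂ) (γ i r)) r (columnColour s) := by
    intro r s
    have h0 : symbolPoly (Sum.inr 0 : σ ⊕ ℂ) = 0 := by simp [symbolPoly]
    rcases r with j | p <;> rcases columnColour s with _ | i
    · exact ⟨Sum.inr 0, h0⟩
    · exact ⟨_, rfl⟩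
    · exact ⟨Sum.inr (γ p.1 p.2), rfl⟩
    · simp only [absorbingEntry]
      split_ifs
      · exact ⟨Sum.inr (β p.1 p.2), rfl⟩
      · exact ⟨Sum.inr 0, h0⟩
  choose A hA using hA
  let e : κ ≃ Fin (Fintype.card κ) := Fintype.equivFin κ
  refine ⟨fun i j => A (e.symm i) (e.symm j), ?_⟩
  have hsum : ∑ y, f y = ∑ y : ι → Fin (B + 1), ∏ j : Fin (l.length + 1),
      ∑ i, symbolPoly (l'.get j i) * (affineCoord y i : MvPolynomial σ ℂ) := by
    refine Finset.sum_congr rfl fun y _ => ?_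
    have h1 := Fin.prod_univ_fun_getElem l' (fun a => affineValue a y)
    have h2 : (l'.map fun a => affineValue a y).prod = f y := by
      rw [hf y]
      simp [l', affineValue, affineCoord, symbolPoly, Fintype.sum_option]
    rw [← h2, ← h1]
    rfl
  rw [hsum]
  refine Eq.trans ?_ h
  simp only [Matrix.permanent, Matrix.of_apply, hA]
  refine Fintype.sum_equiv e.symm.permCongr _ _ fun π => ?_
  refine Fintype.prod_equiv e.symm _ _ fun i => ?_
  simp

end IsAffineProd

end

/-! ### Boolean sums as sums over derivations -/

noncomputable section

/-- The sum of the `k`-th powers of `0` and `1`. -/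
def booleanPowerSum (k : ℕ) : ℂ := if k = 0 then 2 else 1

/-- The sum over e of ∏ e_i^{μ_i} factors into the power sums of {0, 1}. `M` may exceed the support,
so that it can be taken to be all monomials up to a given degree. -/
theorem booleanSum_eq_sum_coeff {σ : Type} [Fintype σ] {u : ℕ} (g : MvPolynomial (σ ⊕ Fin u) ℂ)
    (M : Finset (σ ⊕ Fin u →₀ ℕ)) (hM : g.support ⊆ M) :
    booleanSum g = ∑ μ ∈ M, MvPolynomial.C (MvPolynomial.coeff μ g) *
      (MvPolynomial.C (∏ i, booleanPowerSum (μ (Sum.inr i))) *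
        ∏ x, MvPolynomial.X x ^ μ (Sum.inl x)) := by
  have hg : g = ∑ μ ∈ M, MvPolynomial.monomial μ (MvPolynomial.coeff μ g) := by
    conv_lhs => rw [g.as_sum]
    refine Finset.sum_subset hM fun μ _ hμ => ?_
    rw [MvPolynomial.notMem_support_iff.1 hμ, MvPolynomial.monomial_zero]
  conv_lhs => rw [hg]
  rw [booleanSum]
  simp only [map_sum]
  rw [Finset.sum_comm]
  refine Finset.sum_congr rfl fun μ _ => ?_
  have h1 : ∀ e : Fin u → Bool, MvPolynomial.aeval
      (Sum.elim (fun x => (MvPolynomial.X x : MvPolynomial σ ℂ))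
        (fun i => if e i then (1 : MvPolynomial σ ℂ) else 0))
      (MvPolynomial.monomial μ (MvPolynomial.coeff μ g)) =
      MvPolynomial.C (MvPolynomial.coeff μ g) * (∏ x, MvPolynomial.X x ^ μ (Sum.inl x)) *
        ∏ i, (if e i then (1 : MvPolynomial σ ℂ) else 0) ^ μ (Sum.inr i) := by
    intro e
    rw [MvPolynomial.aeval_monomial, Finsupp.prod_fintype _ _ (fun i => pow_zero _),
      Fintype.prod_sum_type, ← mul_assoc]
    rfl
  rw [Finset.sum_congr rfl fun e _ => h1 e, ← Finset.mul_sum]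
  have h2 : (∑ e : Fin u → Bool, ∏ i, (if e i then (1 : MvPolynomial σ ℂ) else 0) ^
      μ (Sum.inr i)) = MvPolynomial.C (∏ i, booleanPowerSum (μ (Sum.inr i))) := by
    rw [map_prod]
    have h3 : ∀ k, (MvPolynomial.C (booleanPowerSum k) : MvPolynomial σ ℂ) =
        ∑ b : Bool, (if b then (1 : MvPolynomial σ ℂ) else 0) ^ k := by
      intro k
      rw [booleanPowerSum, Fintype.sum_bool]
      by_cases h : k = 0
      · rw [if_pos h, h, pow_zero, pow_zero, ← one_add_one_eq_two, map_add, map_one]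
      · simp [h]
    simp only [h3]
    rw [Finset.prod_univ_sum, Fintype.piFinset_univ]
  rw [h2]
  ring

/-- A sum over a box which is a power: the box variables `z (p, true)` count to `k`, and the
`z (p, false)` are their complements. -/
theorem sum_box_eq_pow {A : Type} [CommRing A] [Algebra ℂ A] (X : A) {D B k : ℕ} (hk : k ≤ D)
    (hB : 1 ≤ B) :
    ∑ z : Fin D × Bool → Fin (B + 1),
      algebraMap ℂ A (((D.choose k : ℂ))⁻¹) *
      (algebraMap ℂ A (if ∑ p, (z (p, true) : ℕ) = k then 1 else 0) *
      ∏ p, (algebraMap ℂ A (if (z (p, true) : ℕ) + z (p, false) = 1 then 1 else 0) *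
        (X * ((z (p, true) : ℕ) : A) + ((z (p, false) : ℕ) : A)))) = X ^ k := by
  classical
  let one' : Fin (B + 1) := ⟨1, by omega⟩
  let zero' : Fin (B + 1) := ⟨0, by omega⟩
  -- The points with nonzero summand come from k-subsets `T` of `Fin D`, with the complement in the
  -- `false` coordinates. Each gives X^k, and the inverse binomial coefficient cancels their number.
  let emb : Finset (Fin D) → Fin D × Bool → Fin (B + 1) := fun T p =>
    if (p.1 ∈ T) ↔ p.2 = true then one' else zero'
  have hsum : ∑ T : Finset (Fin D), algebraMap ℂ A (((D.choose k : ℂ))⁻¹) *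
      (algebraMap ℂ A (if T.card = k then 1 else 0) * X ^ T.card) = X ^ k := by
    have h1 : ∀ T : Finset (Fin D), algebraMap ℂ A (((D.choose k : ℂ))⁻¹) *
      (algebraMap ℂ A (if T.card = k then 1 else 0) * X ^ T.card) =
        if T.card = k then algebraMap ℂ A (((D.choose k : ℂ))⁻¹) * X ^ k else 0 := by
      intro T
      split_ifs with h
      · rw [h]; simp
      · simp
    rw [Finset.sum_congr rfl fun T _ => h1 T, ← Finset.sum_filter, Finset.univ_filter_card_eq,
      Finset.sum_const, Finset.card_powersetCard, Finset.card_univ, Fintype.card_fin,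
      nsmul_eq_mul, ← mul_assoc, ← map_natCast (algebraMap ℂ A), ← map_mul,
      mul_inv_cancel₀ (Nat.cast_ne_zero.2 (Nat.choose_pos hk).ne'), map_one, one_mul]
  rw [← hsum]
  symm
  refine Finset.sum_of_injOn emb ?_ (by simp) ?_ ?_
  · intro T _ T' _ h
    ext p
    have := congrFun h (p, true)
    simp only [emb, iff_true] at this
    by_cases h1 : p ∈ T <;> by_cases h2 : p ∈ T' <;> simp [h1, h2, one', zero'] at this ⊢
  · intro z _ hz
    by_cases hall : ∀ p, (z (p, true) : ℕ) + z (p, false) = 1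
    · exfalso
      apply hz
      refine ⟨Finset.univ.filter fun p => (z (p, true) : ℕ) = 1, by simp, ?_⟩
      funext ⟨p, b⟩
      have := hall p
      simp only [emb, Finset.mem_filter, Finset.mem_univ, true_and]
      rw [Fin.ext_iff]
      cases b
      · by_cases h1 : (z (p, true) : ℕ) = 1
        · simp [h1, zero']; omega
        · simp [h1, one']; omega
      · by_cases h1 : (z (p, true) : ℕ) = 1
        · simp [h1, one']
        · simp [h1, zero']; omega
    · push Not at hall
      obtain ⟨p, hp⟩ := hall
      rw [Finset.prod_eq_zero (Finset.mem_univ p)]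
      · simp
      · simp [hp]
  · intro T _
    have ht : ∀ p, ((emb T (p, true) : Fin (B + 1)) : ℕ) = if p ∈ T then 1 else 0 := by
      intro p
      simp only [emb, iff_true]
      split_ifs <;> rfl
    have hf : ∀ p, ((emb T (p, false) : Fin (B + 1)) : ℕ) = if p ∈ T then 0 else 1 := by
      intro p
      by_cases h : p ∈ T <;> simp [emb, h, one', zero']
    simp only [ht, hf]
    have h1 : ∑ p : Fin D, (if p ∈ T then 1 else 0) = T.card := by simp
    rw [h1]
    congr 2
    have h2 : ∀ p : Fin D, algebraMap ℂ A (if (if p ∈ T then 1 else 0) +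
        (if p ∈ T then 0 else 1) = 1 then 1 else 0) *
        (X * ((if p ∈ T then 1 else 0 : ℕ) : A) + ((if p ∈ T then 0 else 1 : ℕ) : A)) =
        if p ∈ T then X else 1 := by
      intro p
      split_ifs <;> simp_all
    rw [Finset.prod_congr rfl fun p _ => h2 p]
    simp

namespace PolySystem

variable {S τ R : Type} [Fintype S] [DecidableEq S] [Fintype R] [DecidableEq R]

open Classical in
/-- A weighted sum over the derivations in a box, sorted by the monomials that are derived. -/
theorem sum_box_derivations {P : PolySystem S τ R} (hP : P.IsQuadratic) (n : S → ℕ) {D B : ℕ}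
    (hB : 2 * D ≤ B) (M : Finset (τ →₀ ℕ)) (hM : ∀ μ, μ ∈ M ↔ μ.degree ≤ D)
    {A : Type} [CommRing A] [Algebra ℂ A] (θ : (τ →₀ ℕ) → A) :
    ∑ y : R → Fin (B + 1), (if P.IsDerivation n (fun ρ => y ρ) ∧
        (P.leafCount fun ρ => y ρ).degree ≤ D then
      algebraMap ℂ A (P.weight fun ρ => y ρ) * θ (P.leafCount fun ρ => y ρ) else 0) =
      ∑ μ ∈ M, algebraMap ℂ A (P.count n μ) * θ μ := by
  have h1 : ∀ μ ∈ M, algebraMap ℂ A (P.count n μ) * θ μ =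
      ∑ y : R → Fin (B + 1), if P.leafCount (fun ρ => (y ρ : ℕ)) = μ then
        (if P.IsDerivation n (fun ρ => y ρ) then
          algebraMap ℂ A (P.weight fun ρ => y ρ) * θ (P.leafCount fun ρ => y ρ) else 0) else 0 := by
    intro μ hμ
    rw [count, map_sum, Finset.sum_mul]
    simp only [← ite_and]
    rw [← Finset.sum_filter]
    symm
    refine Finset.sum_nbij (fun y ρ => (y ρ : ℕ)) ?_ ?_ ?_ ?_
    · intro y hy
      rw [Finset.mem_filter] at hy
      exact (mem_derivations hP).2 ⟨hy.2.2, hy.2.1⟩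
    · intro y _ y' _ h
      funext ρ
      exact Fin.ext (congrFun h ρ)
    · intro y hy
      rw [Finset.mem_coe] at hy
      -- Multiplicities are at most 2·deg μ ≤ 2D ≤ B, so the box contains every derivation of μ.
      have hlt : ∀ ρ, y ρ < B + 1 := by
        intro ρ
        have h2 := Fintype.mem_piFinset.1 (Finset.mem_filter.1 hy).1 ρ
        have h3 := (hM μ).1 hμ
        rw [Finset.mem_range] at h2
        omega
      refine ⟨fun ρ => ⟨y ρ, hlt ρ⟩, ?_, rfl⟩
      rw [Finset.mem_coe, Finset.mem_filter]
      have := (mem_derivations hP).1 hy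
      exact ⟨Finset.mem_univ _, this.2, this.1⟩
    · intro y hy
      rw [(Finset.mem_filter.1 hy).2.1]
  rw [Finset.sum_congr rfl h1, Finset.sum_comm]
  refine Finset.sum_congr rfl fun y _ => ?_
  rw [Finset.sum_ite_eq]
  simp only [hM, ← ite_and]
  refine if_congr ⟨fun h => ⟨h.2, h.1⟩, fun h => ⟨h.2, h.1⟩⟩ rfl rfl

end PolySystem

end

noncomputable section

/-! ### Boolean sums of circuits are sums of products of affine forms -/

/-- Sums over a box with three kinds of coordinates, where the summand is a product. -/
theorem sum_box_split {R σ Z A : Type} [Fintype R] [DecidableEq R] [Fintype σ] [DecidableEq σ]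
    [Fintype Z] [DecidableEq Z] [CommRing A] {B : ℕ} (G : (R → Fin (B + 1)) → Fin (B + 1) → A)
    (H : (R → Fin (B + 1)) → σ → (Z → Fin (B + 1)) → A) :
    ∑ y : R ⊕ (Unit ⊕ (σ × Z)) → Fin (B + 1),
      G (fun ρ => y (.inl ρ)) (y (.inr (.inl ()))) *
        ∏ x, H (fun ρ => y (.inl ρ)) x (fun z => y (.inr (.inr (x, z)))) =
      ∑ q, ∑ y, G y q * ∏ x, ∑ z, H y x z := by
  refine (Fintype.sum_equiv (Equiv.sumArrowEquivProdArrow _ _ _) _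
    (fun p : (R → Fin (B + 1)) × (Unit ⊕ (σ × Z) → Fin (B + 1)) =>
      G p.1 (p.2 (.inl ())) * ∏ x, H p.1 x (fun z => p.2 (.inr (x, z)))) (fun y => rfl)).trans ?_
  rw [Fintype.sum_prod_type, Finset.sum_comm (γ := Fin (B + 1))]
  refine Finset.sum_congr rfl fun y _ => ?_
  refine (Fintype.sum_equiv (Equiv.sumArrowEquivProdArrow _ _ _) _
    (fun p : (Unit → Fin (B + 1)) × (σ × Z → Fin (B + 1)) =>
      G y (p.1 ()) * ∏ x, H y x (fun z => p.2 (x, z))) (fun y => rfl)).trans ?_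
  rw [Fintype.sum_prod_type]
  refine (Fintype.sum_equiv (Equiv.funUnique Unit (Fin (B + 1))) _
      (fun q => ∑ p : σ × Z → Fin (B + 1), G y q * ∏ x, H y x (fun z => p (x, z)))
      (fun q => rfl)).trans ?_
  refine Finset.sum_congr rfl fun q _ => ?_
  rw [← Finset.mul_sum, Finset.prod_univ_sum, Fintype.piFinset_univ]
  congr 1
  exact Fintype.sum_equiv (Equiv.curry _ _ _) _ (fun z => ∏ x, H y x (z x)) (fun y => rfl)

namespace PolySystem

variable {s u : ℕ} {σ R : Type} [Fintype R] [DecidableEq R]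

/-- The summand of the constants in `PolySystem.sum_affineSummand`. -/
def scalarSummand (P : PolySystem (Fin s) (σ ⊕ Fin u) R) (r : Fin s) (c₀ : ℂ) (D : ℕ)
    (y : R → ℕ) (q : ℕ) : MvPolynomial σ ℂ :=
  (∏ v, MvPolynomial.C
      (if (P.outCount y v : ℤ) - P.useCount y v - (if v = r then q else 0 : ℕ) = 0 then 1 else 0)) *
    ((∏ v, MvPolynomial.C ((P.outCount y v).factorial : ℂ)) *
    ((∏ ρ, MvPolynomial.C (P.c ρ ^ y ρ / ((y ρ).factorial : ℂ))) *
    (MvPolynomial.C (if (P.leafCount y).degree ≤ D then 1 else 0) *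
    ((∏ i, MvPolynomial.C (booleanPowerSum (P.leafCount y (Sum.inr i)))) *
    MvPolynomial.C (if q = 0 then c₀ else if q = 1 then 1 else 0)))))

/-- The summand for the powers of the variable `x` in `PolySystem.sum_affineSummand`. -/
def variableSummand (P : PolySystem (Fin s) (σ ⊕ Fin u) R) (D : ℕ)
    (y : R → ℕ) (x : σ) (z : Fin D × Bool → ℕ) : MvPolynomial σ ℂ :=
  MvPolynomial.C (((D.choose (P.leafCount y (Sum.inl x)) : ℂ))⁻¹) *
    (MvPolynomial.C (if ∑ p, z (p, true) = P.leafCount y (Sum.inl x) then 1 else 0) *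
      ∏ p, (MvPolynomial.C (if z (p, true) + z (p, false) = 1 then 1 else 0) *
        (MvPolynomial.X x * ((z (p, true) : ℕ) : MvPolynomial σ ℂ) +
          ((z (p, false) : ℕ) : MvPolynomial σ ℂ))))

/-- The boolean sum of a polynomial that is determined by a triangular quadratic system. -/
theorem sum_scalarSummand [Fintype σ] {P : PolySystem (Fin s) (σ ⊕ Fin u) R}
    (hP : P.IsQuadratic) {rank : Fin s → ℕ} (hT : P.IsTriangular rank)
    {V : Fin s → MvPolynomial (σ ⊕ Fin u) ℂ}
    (hV0 : ∀ v, V v ∈ MvPolynomial.idealOfVars (σ ⊕ Fin u) ℂ)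
    (hV : ∀ v, V v = ∑ ρ, if P.head ρ = v then
      MvPolynomial.monomial (P.leafs ρ) (P.c ρ) * ∏ w, V w ^ P.child ρ w else 0)
    (r : Fin s) (c₀ : ℂ) {D B : ℕ} (hB : 2 * D ≤ B) (hB1 : 1 ≤ B)
    (hD : (V r + MvPolynomial.C c₀).totalDegree ≤ D) :
    ∑ q : Fin (B + 1), ∑ y : R → Fin (B + 1), P.scalarSummand r c₀ D (fun ρ => y ρ) q *
        ∏ x, MvPolynomial.X x ^ (P.leafCount (fun ρ => (y ρ : ℕ)) (Sum.inl x)) =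
      booleanSum (V r + MvPolynomial.C c₀) := by
  classical
  set M : Finset (σ ⊕ Fin u →₀ ℕ) := (Finsupp.finite_of_degree_le D).toFinset with hMdef
  have hM : ∀ μ, μ ∈ M ↔ μ.degree ≤ D := by
    intro μ
    rw [hMdef, Set.Finite.mem_toFinset]; rfl
  have hsupp : (V r + MvPolynomial.C c₀).support ⊆ M := by
    intro μ hμ
    rw [hM]
    exact (MvPolynomial.le_totalDegree hμ).trans hD
  rw [booleanSum_eq_sum_coeff _ M hsupp]
  set θ : (σ ⊕ Fin u →₀ ℕ) → MvPolynomial σ ℂ := fun μ =>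
    MvPolynomial.C (∏ i, booleanPowerSum (μ (Sum.inr i))) *
      ∏ x, MvPolynomial.X x ^ μ (Sum.inl x) with hθ
  -- Derivations start from V_r^q. The value q = 0 accounts for the constant term, q = 1 for `V r`,
  -- and all other q are discarded.
  let χ : ℕ → ℂ := fun q => if q = 0 then c₀ else if q = 1 then 1 else 0
  have hterm : ∀ (q : ℕ) (y : R → ℕ), P.scalarSummand r c₀ D y q *
      ∏ x, MvPolynomial.X x ^ (P.leafCount y (Sum.inl x)) =
      MvPolynomial.C (χ q) * (if P.IsDerivation (Pi.single r q) y ∧ (P.leafCount y).degree ≤ D then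
        algebraMap ℂ (MvPolynomial σ ℂ) (P.weight y) * θ (P.leafCount y) else 0) := by
    intro q y
    have hder : (∏ v, MvPolynomial.C (if (P.outCount y v : ℤ) - P.useCount y v -
        (if v = r then q else 0 : ℕ) = 0 then 1 else 0) : MvPolynomial σ ℂ) =
        if P.IsDerivation (Pi.single r q) y then 1 else 0 := by
      split_ifs with h
      · refine Finset.prod_eq_one fun v _ => ?_
        have := h v
        rw [Pi.single_apply] at this
        rw [if_pos, map_one]
        omega
      · rw [IsDerivation] at h
        push Not at h
        obtain ⟨v, hv⟩ := h
        rw [Pi.single_apply] at hv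
        refine Finset.prod_eq_zero (Finset.mem_univ v) ?_
        rw [if_neg, map_zero]
        omega
    rw [scalarSummand, hder, MvPolynomial.algebraMap_eq, ite_and, weight, hθ, map_mul, map_prod,
      map_prod]
    simp only [χ]
    split_ifs <;> simp [map_prod] <;> ring
  simp only [hterm, ← Finset.mul_sum]
  rw [Finset.sum_congr rfl fun (q : Fin (B + 1)) _ => congrArg _
    (sum_box_derivations hP (Pi.single r (q : ℕ)) hB M hM θ)]
  simp only [Finset.mul_sum]
  rw [Finset.sum_comm]
  refine Finset.sum_congr rfl fun μ _ => ?_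
  have hcount : ∀ n, P.count n μ = MvPolynomial.coeff μ (∏ v, V v ^ n v) := fun n =>
    (coeff_prod_pow_eq_count hP hT hV0 hV n μ).symm
  obtain ⟨B', rfl⟩ : ∃ B', B = B' + 1 := ⟨B - 1, by omega⟩
  rw [Fin.sum_univ_succ, Fin.sum_univ_succ, Finset.sum_eq_zero (s := Finset.univ (α := Fin B'))]
  · have h1 : ∏ v, V v ^ (Pi.single r 1 : Fin s → ℕ) v = V r := by
      rw [Finset.prod_eq_single r] <;> simp +contextual
    have h0 : ∏ v, V v ^ (Pi.single r 0 : Fin s → ℕ) v = 1 := by simp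
    simp only [Fin.val_zero, Fin.val_succ, zero_add, hcount, h1, h0, add_zero, hθ, χ, if_true,
      one_ne_zero, if_false, MvPolynomial.algebraMap_eq, map_one, one_mul, MvPolynomial.coeff_add,
      map_add, add_mul]
    rw [← mul_assoc, ← map_mul, ← MvPolynomial.coeff_C_mul, mul_one, add_comm]
  · intro j _
    simp [χ]

end PolySystem

end

/-! ### The summands as products of affine forms -/

noncomputable section

namespace PolySystem

set_option linter.unusedSectionVars false

variable {s u : ℕ} {σ R : Type} [Fintype R] [DecidableEq R]

theorem child_le_two {P : PolySystem (Fin s) (σ ⊕ Fin u) R} (hP : P.IsQuadratic) (ρ : R)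
    (v : Fin s) : P.child ρ v ≤ 2 := by
  have h1 := hP ρ
  have h2 := Finset.single_le_sum (f := P.child ρ) (fun _ _ => Nat.zero_le _) (Finset.mem_univ v)
  omega

theorem degree_leafs_le_two {P : PolySystem (Fin s) (σ ⊕ Fin u) R} (hP : P.IsQuadratic) (ρ : R) :
    (P.leafs ρ).degree ≤ 2 := by
  have h1 := hP ρ
  omega

theorem leafs_le_two {P : PolySystem (Fin s) (σ ⊕ Fin u) R} (hP : P.IsQuadratic) (ρ : R)
    (t : σ ⊕ Fin u) : P.leafs ρ t ≤ 2 :=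
  (Finsupp.le_degree t (P.leafs ρ)).trans (degree_leafs_le_two hP ρ)

theorem sum_elim_mul {Z : Type} [Fintype Z] (kR : R → ℤ) (kq : ℤ) (kZ : Z → ℤ)
    (y : R ⊕ (Unit ⊕ Z) → ℤ) :
    ∑ i, Sum.elim kR (Sum.elim (fun _ => kq) kZ) i * y i =
      ∑ ρ, kR ρ * y (.inl ρ) + (kq * y (.inr (.inl ())) + ∑ z, kZ z * y (.inr (.inr z))) := by
  simp [Fintype.sum_sum_type]

theorem abs_sum_elim_le {Z : Type} {kR : R → ℤ} {kq : ℤ} {kZ : Z → ℤ} (hR : ∀ ρ, |kR ρ| ≤ 2)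
    (hq : |kq| ≤ 2) (hZ : ∀ z, |kZ z| ≤ 2) (i : R ⊕ (Unit ⊕ Z)) :
    |Sum.elim kR (Sum.elim (fun _ => kq) kZ) i| ≤ 2 := by
  rcases i with ρ | _ | z
  · exact hR ρ
  · exact hq
  · exact hZ z

theorem isAffineProd_linear [Fintype σ] {D B : ℕ}
    {f : (R ⊕ (Unit ⊕ (σ × (Fin D × Bool))) → Fin (B + 1)) → MvPolynomial σ ℂ} (Φ : ℤ → ℂ)
    (kR : R → ℤ) (kq : ℤ) (kZ : σ × (Fin D × Bool) → ℤ) (hR : ∀ ρ, |kR ρ| ≤ 2)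
    (hq : |kq| ≤ 2) (hZ : ∀ z, |kZ z| ≤ 2)
    (hf : ∀ y, f y = MvPolynomial.C (Φ (∑ ρ, kR ρ * (y (.inl ρ) : ℕ) +
      (kq * (y (.inr (.inl ())) : ℕ) + ∑ z, kZ z * (y (.inr (.inr z)) : ℕ))))) :
    IsAffineProd f (4 * B * Fintype.card (R ⊕ (Unit ⊕ (σ × (Fin D × Bool)))) + 2) := by
  refine IsAffineProd.ofLinear' Φ (Sum.elim kR (Sum.elim (fun _ => kq) kZ))
    (abs_sum_elim_le hR hq hZ) fun y => ?_
  rw [hf, sum_elim_mul kR kq kZ (fun i => ((y i : ℕ) : ℤ))]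

theorem cast_outCount (P : PolySystem (Fin s) (σ ⊕ Fin u) R) (y : R → ℕ) (v : Fin s) :
    (P.outCount y v : ℤ) = ∑ ρ, (if P.head ρ = v then 1 else 0) * (y ρ : ℤ) := by
  rw [outCount]; push_cast
  refine Finset.sum_congr rfl fun ρ _ => ?_
  split_ifs <;> simp

theorem cast_useCount (P : PolySystem (Fin s) (σ ⊕ Fin u) R) (y : R → ℕ) (v : Fin s) :
    (P.useCount y v : ℤ) = ∑ ρ, (P.child ρ v : ℤ) * (y ρ : ℤ) := by
  rw [useCount]; push_cast
  exact Finset.sum_congr rfl fun ρ _ => mul_comm _ _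

theorem cast_leafCount (P : PolySystem (Fin s) (σ ⊕ Fin u) R) (y : R → ℕ) (t : σ ⊕ Fin u) :
    (P.leafCount y t : ℤ) = ∑ ρ, (P.leafs ρ t : ℤ) * (y ρ : ℤ) := by
  rw [leafCount, Finsupp.finsetSum_apply]; push_cast
  exact Finset.sum_congr rfl fun ρ _ => by simp [mul_comm]

theorem cast_degree_leafCount (P : PolySystem (Fin s) (σ ⊕ Fin u) R) (y : R → ℕ) :
    ((P.leafCount y).degree : ℤ) = ∑ ρ, ((P.leafs ρ).degree : ℤ) * (y ρ : ℤ) := by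
  rw [leafCount, map_sum]; push_cast
  exact Finset.sum_congr rfl fun ρ _ => by simp [mul_comm]

theorem abs_natCast_le_two {n : ℕ} (h : n ≤ 2) : |(n : ℤ)| ≤ 2 := by
  rw [Nat.abs_cast]; exact_mod_cast h

theorem abs_zero_le_two : |(0 : ℤ)| ≤ 2 := by norm_num

theorem abs_ite_le_two (p : Prop) [Decidable p] : |(if p then 1 else 0 : ℤ)| ≤ 2 := by
  split_ifs <;> norm_num

/-- Each factor depends on the point through a single integer linear form. Its coefficients are at
most 2 in absolute value because a quadratic rule contains at most two symbols. -/
theorem isAffineProd_scalarSummand [Fintype σ] {P : PolySystem (Fin s) (σ ⊕ Fin u) R}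
    (hP : P.IsQuadratic) (r : Fin s) (c₀ : ℂ) {D B N : ℕ}
    (hN : N = 4 * B * Fintype.card (R ⊕ (Unit ⊕ (σ × (Fin D × Bool)))) + 2) :
    IsAffineProd (fun y : R ⊕ (Unit ⊕ (σ × (Fin D × Bool))) → Fin (B + 1) =>
      P.scalarSummand r c₀ D (fun ρ => y (.inl ρ)) (y (.inr (.inl ()))))
      (s * N + (s * N + (Fintype.card R * N + (N + (u * N + N))))) := by
  have cs : Fintype.card (Fin s) * N = s * N := by rw [Fintype.card_fin]
  have cu : Fintype.card (Fin u) * N = u * N := by rw [Fintype.card_fin]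
  rw [← cs, ← cu]
  subst hN
  refine .mul (.prod fun v => ?_) (.mul (.prod fun v => ?_) (.mul (.prod fun ρ => ?_)
    (.mul ?_ (.mul (.prod fun i => ?_) ?_))))
  · refine isAffineProd_linear (fun t => if t = 0 then 1 else 0)
      (fun ρ => (if P.head ρ = v then 1 else 0) - (P.child ρ v : ℤ))
      (-(if v = r then 1 else 0)) (fun _ => 0) (fun ρ => ?_) ?_ (fun _ => abs_zero_le_two)
      fun y => ?_
    · have := child_le_two hP ρ v
      rw [abs_le]
      split_ifs <;> constructor <;> omega
    · rw [abs_neg]; exact abs_ite_le_two _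
    · rw [cast_outCount, cast_useCount]
      simp only [sub_mul, Finset.sum_sub_distrib, zero_mul, Finset.sum_const_zero, add_zero]
      congr 3
      split_ifs <;> simp [sub_eq_add_neg]
  · refine isAffineProd_linear (fun t => (t.toNat.factorial : ℂ))
      (fun ρ => if P.head ρ = v then 1 else 0) 0 (fun _ => 0) (fun ρ => abs_ite_le_two _)
      abs_zero_le_two (fun _ => abs_zero_le_two) fun y => ?_
    rw [← cast_outCount P (fun ρ => (y (.inl ρ) : ℕ))]
    simp
  · refine isAffineProd_linear (fun t => P.c ρ ^ t.toNat / (t.toNat.factorial : ℂ))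
      (fun ρ' => if ρ' = ρ then 1 else 0) 0 (fun _ => 0) (fun ρ => abs_ite_le_two _)
      abs_zero_le_two (fun _ => abs_zero_le_two) fun y => ?_
    simp
  · refine isAffineProd_linear (fun t => if t ≤ D then 1 else 0)
      (fun ρ => ((P.leafs ρ).degree : ℤ)) 0 (fun _ => 0)
      (fun ρ => abs_natCast_le_two (degree_leafs_le_two hP ρ))
      abs_zero_le_two (fun _ => abs_zero_le_two) fun y => ?_
    rw [← cast_degree_leafCount P (fun ρ => (y (.inl ρ) : ℕ))]
    simp
  · refine isAffineProd_linear (fun t => booleanPowerSum t.toNat)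
      (fun ρ => (P.leafs ρ (Sum.inr i) : ℤ)) 0 (fun _ => 0)
      (fun ρ => abs_natCast_le_two (leafs_le_two hP ρ _))
      abs_zero_le_two (fun _ => abs_zero_le_two) fun y => ?_
    rw [← cast_leafCount P (fun ρ => (y (.inl ρ) : ℕ))]
    simp
  · refine isAffineProd_linear (fun t => if t = 0 then c₀ else if t = 1 then 1 else 0)
      (fun _ => 0) 1 (fun _ => 0) (fun _ => abs_zero_le_two) (by norm_num)
      (fun _ => abs_zero_le_two) fun y => ?_
    simp

theorem isAffineProd_variableSummand [Fintype σ] {P : PolySystem (Fin s) (σ ⊕ Fin u) R}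
    (hP : P.IsQuadratic) {D B N : ℕ} (x : σ)
    (hN : N = 4 * B * Fintype.card (R ⊕ (Unit ⊕ (σ × (Fin D × Bool)))) + 2) :
    IsAffineProd (fun y : R ⊕ (Unit ⊕ (σ × (Fin D × Bool))) → Fin (B + 1) =>
      P.variableSummand D (fun ρ => y (.inl ρ)) x (fun z => y (.inr (.inr (x, z)))))
      (N + (N + D * (N + 1))) := by
  classical
  have cD : Fintype.card (Fin D) * (N + 1) = D * (N + 1) := by rw [Fintype.card_fin]
  rw [← cD]
  subst hN
  refine .mul ?_ (.mul ?_ (.prod fun p => .mul ?_ (.X_mul_add x (by simp))))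
  · refine isAffineProd_linear (fun t => ((D.choose t.toNat : ℂ))⁻¹)
      (fun ρ => (P.leafs ρ (Sum.inl x) : ℤ)) 0 (fun _ => 0)
      (fun ρ => abs_natCast_le_two (leafs_le_two hP ρ _))
      abs_zero_le_two (fun _ => abs_zero_le_two) fun y => ?_
    rw [← cast_leafCount P (fun ρ => (y (.inl ρ) : ℕ))]
    simp
  · refine isAffineProd_linear (fun t => if t = 0 then 1 else 0)
      (fun ρ => -(P.leafs ρ (Sum.inl x) : ℤ)) 0
      (fun z => if z.1 = x ∧ z.2.2 = true then 1 else 0)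
      (fun ρ => by rw [abs_neg]; exact abs_natCast_le_two (leafs_le_two hP ρ _))
      abs_zero_le_two (fun z => abs_ite_le_two (z.1 = x ∧ z.2.2 = true)) fun y => ?_
    have h1 : ∑ z : σ × (Fin D × Bool), (if z.1 = x ∧ z.2.2 = true then 1 else 0) *
        ((y (.inr (.inr z)) : ℕ) : ℤ) = ∑ p : Fin D, ((y (.inr (.inr (x, (p, true)))) : ℕ) : ℤ) := by
      rw [Fintype.sum_prod_type, Finset.sum_eq_single x]
      · rw [Fintype.sum_prod_type]
        simp
      · intro x' _ hx'
        simp [hx']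
      · simp
    rw [h1]
    simp only [neg_mul, Finset.sum_neg_distrib, zero_mul, zero_add]
    rw [← cast_leafCount P (fun ρ => (y (.inl ρ) : ℕ)), ← Nat.cast_sum]
    refine congrArg MvPolynomial.C (if_congr ?_ rfl rfl)
    omega
  · refine isAffineProd_linear (fun t => if t = 1 then 1 else 0) (fun _ => 0) 0
      (fun z => if z.1 = x ∧ z.2.1 = p then 1 else 0)
      (fun _ => abs_zero_le_two) abs_zero_le_two
      (fun z => abs_ite_le_two (z.1 = x ∧ z.2.1 = p)) fun y => ?_
    have h1 : ∑ z : σ × (Fin D × Bool), (if z.1 = x ∧ z.2.1 = p then 1 else 0) *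
        ((y (.inr (.inr z)) : ℕ) : ℤ) = ((y (.inr (.inr (x, (p, true)))) : ℕ) : ℤ) +
          ((y (.inr (.inr (x, (p, false)))) : ℕ) : ℤ) := by
      rw [Fintype.sum_prod_type, Finset.sum_eq_single x]
      · rw [Fintype.sum_prod_type, Finset.sum_eq_single p]
        · simp
        · intro p' _ hp'
          simp [hp']
        · simp
      · intro x' _ hx'
        simp [hx']
      · simp
    rw [h1]
    simp only [zero_mul, Finset.sum_const_zero, zero_add]
    refine congrArg MvPolynomial.C (if_congr ?_ rfl rfl)
    omega

/-- The boolean sum of a polynomial that is determined by a triangular quadratic system is a sum of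
products of affine forms. -/
theorem exists_isAffineProd_booleanSum [Fintype σ] [DecidableEq σ]
    {P : PolySystem (Fin s) (σ ⊕ Fin u) R}
    (hP : P.IsQuadratic) {rank : Fin s → ℕ} (hT : P.IsTriangular rank)
    {V : Fin s → MvPolynomial (σ ⊕ Fin u) ℂ}
    (hV0 : ∀ v, V v ∈ MvPolynomial.idealOfVars (σ ⊕ Fin u) ℂ)
    (hV : ∀ v, V v = ∑ ρ, if P.head ρ = v then
      MvPolynomial.monomial (P.leafs ρ) (P.c ρ) * ∏ w, V w ^ P.child ρ w else 0)
    (r : Fin s) (c₀ : ℂ) {D B N : ℕ} (hB : 2 * D ≤ B) (hB1 : 1 ≤ B)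
    (hD : (V r + MvPolynomial.C c₀).totalDegree ≤ D)
    (hN : N = 4 * B * Fintype.card (R ⊕ (Unit ⊕ (σ × (Fin D × Bool)))) + 2) :
    ∃ f : (R ⊕ (Unit ⊕ (σ × (Fin D × Bool))) → Fin (B + 1)) → MvPolynomial σ ℂ,
      ∑ y, f y = booleanSum (V r + MvPolynomial.C c₀) ∧
      IsAffineProd f (s * N + (s * N + (Fintype.card R * N + (N + (u * N + N)))) +
        Fintype.card σ * (N + (N + D * (N + 1)))) := by
  refine ⟨fun y => P.scalarSummand r c₀ D (fun ρ => y (.inl ρ)) (y (.inr (.inl ()))) *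
      ∏ x, P.variableSummand D (fun ρ => y (.inl ρ)) x (fun z => y (.inr (.inr (x, z)))), ?_,
    (isAffineProd_scalarSummand hP r c₀ hN).mul
      (.prod fun x => isAffineProd_variableSummand hP x hN)⟩
  rw [sum_box_split (B := B) (fun y q => P.scalarSummand r c₀ D (fun ρ => y ρ) q)
    (fun y x z => P.variableSummand D (fun ρ => y ρ) x (fun t => z t)),
    ← sum_scalarSummand hP hT hV0 hV r c₀ hB hB1 hD]
  refine Finset.sum_congr rfl fun q _ => Finset.sum_congr rfl fun y _ => ?_
  -- The power trick needs exponents at most `D`; beyond this degree the cutoff factor in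
  -- `scalarSummand` is zero.
  by_cases hle : (P.leafCount fun ρ => (y ρ : ℕ)).degree ≤ D
  · congr 1
    refine Finset.prod_congr rfl fun x _ => ?_
    exact sum_box_eq_pow (MvPolynomial.X x : MvPolynomial σ ℂ)
      ((Finsupp.le_degree _ _).trans hle) hB1
  · have : P.scalarSummand r c₀ D (fun ρ => y ρ) q = 0 := by
      rw [scalarSummand, if_neg hle]
      simp
    rw [this, zero_mul, zero_mul]

end PolySystem

end

noncomputable section

/-! ### Boolean sums of circuits are permanents -/

/-- The number of box coordinates used for a circuit of size `s` in `a + u` variables that computes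
a polynomial of degree `D`. -/
def boxDim (s a u D : ℕ) : ℕ := s * (a + u + s * s) + (1 + a * (D * 2))

/-- The number of affine forms needed for a function of one integer linear form. -/
def formCount (s a u D : ℕ) : ℕ := 4 * (2 * D + 1) * boxDim s a u D + 2

/-- A bound for the size of a permanent that expresses the boolean sum of a circuit. -/
def permanentBound (s a u D : ℕ) : ℕ :=
  (s * formCount s a u D + (s * formCount s a u D + (s * (a + u + s * s) * formCount s a u D +
    (formCount s a u D + (u * formCount s a u D + formCount s a u D)))) +
    a * (formCount s a u D + (formCount s a u D + D * (formCount s a u D + 1))) + 1) *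
    (boxDim s a u D + 2)

/-- The size `d` is fixed before the scalar `c`, because the scalar used later depends on `d`. -/
theorem exists_permanent_eq_booleanSum {σ : Type} [Fintype σ] {u s : ℕ}
    (g : MvPolynomial (σ ⊕ Fin u) ℂ) (hg : HasCircuitOfSize g s) :
    ∃ d ≤ permanentBound s (Fintype.card σ) u g.totalDegree, ∀ c : ℂ, ∃ A : Fin d → Fin d → σ ⊕ ℂ,
      (Matrix.of fun i j => symbolPoly (A i j)).permanent = MvPolynomial.C c * booleanSum g := by
  classical
  obtain ⟨Γ, r, hΓ⟩ := hg
  obtain ⟨P, hP, hT, hV⟩ := Γ.exists_polySystem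
  have hgV : Γ.reducedValue r + MvPolynomial.C (MvPolynomial.constantCoeff g) = g := by
    rw [ArithCircuit.reducedValue, hΓ, sub_add_cancel]
  -- The box bound is 2D + 1 and not 2D, so that it admits the value 1 even when D = 0.
  obtain ⟨f, hf, hprod⟩ := PolySystem.exists_isAffineProd_booleanSum hP hT
    Γ.reducedValue_mem_idealOfVars hV r (MvPolynomial.constantCoeff g) (D := g.totalDegree)
    (B := 2 * g.totalDegree + 1) (by omega) (by omega) (by rw [hgV]) rfl
  obtain ⟨d, hd, h⟩ := hprod.exists_permanent
  refine ⟨d, hd.trans (le_of_eq ?_), fun c => ?_⟩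
  · have h1 : Fintype.card (Fin s × ((σ ⊕ Fin u) ⊕ (Fin s × Fin s))) =
        s * (Fintype.card σ + u + s * s) := by simp
    have h2 : Fintype.card ((Fin s × ((σ ⊕ Fin u) ⊕ (Fin s × Fin s))) ⊕
        (Unit ⊕ (σ × (Fin g.totalDegree × Bool)))) =
        boxDim s (Fintype.card σ) u g.totalDegree := by simp [boxDim]
    rw [h1, h2]
    rfl
  · obtain ⟨A, hA⟩ := h c
    rw [hgV] at hf
    refine ⟨A, ?_⟩
    rw [hA, ← hf]
    congr!

/-! ### Closure properties of polynomially bounded functions -/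

namespace PBounded

theorem mono {f g : ℕ → ℕ} (hg : PBounded g) (h : ∀ n, f n ≤ g n) : PBounded f := by
  obtain ⟨q, hq⟩ := hg
  exact ⟨q, fun n => (h n).trans (hq n)⟩

theorem const (c : ℕ) : PBounded fun _ => c := ⟨Polynomial.C c, fun n => by simp⟩

theorem id : PBounded fun n => n := ⟨Polynomial.X, fun n => by simp⟩

theorem add {f g : ℕ → ℕ} (hf : PBounded f) (hg : PBounded g) : PBounded fun n => f n + g n := by
  obtain ⟨p, hp⟩ := hf
  obtain ⟨q, hq⟩ := hg
  exact ⟨p + q, fun n => by rw [Polynomial.eval_add]; exact add_le_add (hp n) (hq n)⟩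

theorem mul {f g : ℕ → ℕ} (hf : PBounded f) (hg : PBounded g) : PBounded fun n => f n * g n := by
  obtain ⟨p, hp⟩ := hf
  obtain ⟨q, hq⟩ := hg
  exact ⟨p * q, fun n => by rw [Polynomial.eval_mul]; exact Nat.mul_le_mul (hp n) (hq n)⟩

theorem pow {f : ℕ → ℕ} (hf : PBounded f) (k : ℕ) : PBounded fun n => f n ^ k := by
  obtain ⟨p, hp⟩ := hf
  exact ⟨p ^ k, fun n => by rw [Polynomial.eval_pow]; exact Nat.pow_le_pow_left (hp n) k⟩

theorem permanentBound {s a u D : ℕ → ℕ} (hs : PBounded s) (ha : PBounded a) (hu : PBounded u)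
    (hD : PBounded D) : PBounded fun n => permanentBound (s n) (a n) (u n) (D n) := by
  have h1 : PBounded fun n => s n * (a n + u n + s n * s n) := hs.mul ((ha.add hu).add (hs.mul hs))
  have h2 : PBounded fun n => boxDim (s n) (a n) (u n) (D n) :=
    h1.add ((const 1).add (ha.mul (hD.mul (const 2))))
  have h3 : PBounded fun n => formCount (s n) (a n) (u n) (D n) :=
    (((const 4).mul (((const 2).mul hD).add (const 1))).mul h2).add (const 2)
  exact ((((hs.mul h3).add ((hs.mul h3).add ((h1.mul h3).add (h3.add ((hu.mul h3).add h3))))).add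
    (ha.mul (h3.add (h3.add (hD.mul (h3.add (const 1))))))).add (const 1)).mul (h2.add (const 2))

end PBounded

end

noncomputable section

/-! ### Hyperpfaffians of block tensors -/

/-- The entries at positions 0 and `k` reveal the two block numbers. -/
theorem blockIndex_injective {k d : ℕ} (hk : 0 < k) {i j i' j' : Fin d}
    (h : blockIndex k d i j = blockIndex k d i' j') : i = i' ∧ j = j' := by
  have h1 := finProdFinEquiv.injective (congrFun h ⟨0, by omega⟩)
  have h2 := finProdFinEquiv.injective (congrFun h ⟨k, by omega⟩)
  simp only [Prod.mk.injEq, hk, lt_irrefl, if_true, if_false] at h1 h2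
  exact ⟨h1.1, h2.1⟩

theorem blockTensor_blockIndex {k d : ℕ} (hk : 0 < k) (i j : Fin d) :
    blockTensor k d (blockIndex k d i j) = MvPolynomial.X (i, j) := by
  rw [blockTensor, Finset.sum_eq_single i, Finset.sum_eq_single j]
  · simp
  · intro j' _ hj'
    exact if_neg fun h => hj' (blockIndex_injective hk h).2.symm
  · simp
  · intro i' _ hi'
    exact Finset.sum_eq_zero fun j' _ => if_neg fun h => hi' (blockIndex_injective hk h).1.symm
  · simp

theorem blockTensor_eq_zero {k d : ℕ} {a : TensorIndex k d} (h : ∀ i j, a ≠ blockIndex k d i j) :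
    blockTensor k d a = 0 :=
  Finset.sum_eq_zero fun i _ => Finset.sum_eq_zero fun j _ => if_neg (h i j)

/-- The permutation of `Fin (d * (2 * k))` that permutes the first halves of the blocks by `α` and
the second halves by `β`. -/
def blockPerm (k d : ℕ) (p : Equiv.Perm (Fin d) × Equiv.Perm (Fin d)) :
    Equiv.Perm (Fin (d * (2 * k))) :=
  finProdFinEquiv.permCongr
    (Equiv.prodCongrLeft fun l : Fin (2 * k) => if (l : ℕ) < k then p.1 else p.2)

theorem blockPerm_apply (k d : ℕ) (p : Equiv.Perm (Fin d) × Equiv.Perm (Fin d)) (i : Fin d) :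
    (fun l => blockPerm k d p (finProdFinEquiv (i, l))) = blockIndex k d (p.1 i) (p.2 i) := by
  funext l
  simp only [blockPerm, blockIndex, Equiv.permCongr_apply, Equiv.symm_apply_apply,
    Equiv.prodCongrLeft_apply]
  split_ifs <;> rfl

/-- The permutation acts separately on 2k positions, as the first permutation on k of them and as
the second on the other k. -/
theorem sign_blockPerm (k d : ℕ) (p : Equiv.Perm (Fin d) × Equiv.Perm (Fin d)) :
    Equiv.Perm.sign (blockPerm k d p) = Equiv.Perm.sign (p.1 * p.2⁻¹) ^ k := by
  rw [blockPerm, Equiv.Perm.sign_permCongr, Equiv.Perm.sign_prodCongrLeft]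
  simp only [apply_ite Equiv.Perm.sign]
  rw [Fin.prod_univ_eq_prod_range (fun l => if l < k then Equiv.Perm.sign p.1 else
    Equiv.Perm.sign p.2) (2 * k), two_mul, Finset.prod_range_add, Equiv.Perm.sign_mul,
    Equiv.Perm.sign_inv, mul_pow]
  congr 1
  · rw [Finset.prod_congr rfl fun l hl => if_pos (Finset.mem_range.1 hl), Finset.prod_const,
      Finset.card_range]
  · rw [Finset.prod_congr rfl fun l _ => if_neg (by omega), Finset.prod_const, Finset.card_range]

theorem aeval_blockTensor_hyperpfaffian {k : ℕ} (hk : 0 < k) (d : ℕ) :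
    MvPolynomial.aeval (blockTensor k d) (hyperpfaffian k d) =
      (d.factorial : MvPolynomial (Fin d × Fin d) ℂ) * ∑ τ : Equiv.Perm (Fin d),
        MvPolynomial.C (((Equiv.Perm.sign τ ^ k : ℤˣ) : ℤ) : ℂ) *
          ∏ i, MvPolynomial.X (τ i, i) := by
  have h1 : MvPolynomial.aeval (blockTensor k d) (hyperpfaffian k d) =
      ∑ π : Equiv.Perm (Fin (d * (2 * k))), MvPolynomial.C (((Equiv.Perm.sign π : ℤ) : ℂ)) *
        ∏ i : Fin d, blockTensor k d (fun j => π (finProdFinEquiv (i, j))) := by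
    simp [hyperpfaffian, map_sum, map_prod]
  have h2 : ∑ p : Equiv.Perm (Fin d) × Equiv.Perm (Fin d),
      MvPolynomial.C (((Equiv.Perm.sign (p.1 * p.2⁻¹) ^ k : ℤˣ) : ℤ) : ℂ) *
        ∏ i, (MvPolynomial.X (p.1 i, p.2 i) : MvPolynomial (Fin d × Fin d) ℂ) =
      ∑ π : Equiv.Perm (Fin (d * (2 * k))), MvPolynomial.C (((Equiv.Perm.sign π : ℤ) : ℂ)) *
        ∏ i : Fin d, blockTensor k d (fun j => π (finProdFinEquiv (i, j))) := by
    refine Finset.sum_of_injOn (blockPerm k d) ?_ (by simp) ?_ ?_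
    · intro p _ p' _ h
      have h3 : ∀ i, p.1 i = p'.1 i ∧ p.2 i = p'.2 i := fun i =>
        blockIndex_injective hk (by rw [← blockPerm_apply, h, blockPerm_apply])
      exact Prod.ext (Equiv.ext fun i => (h3 i).1) (Equiv.ext fun i => (h3 i).2)
    · intro π _ hπ
      by_cases hall : ∀ i : Fin d, ∃ q : Fin d × Fin d,
          (fun j => π (finProdFinEquiv (i, j))) = blockIndex k d q.1 q.2
      · exfalso
        apply hπ
        choose q hq using hall
        -- Two blocks with the same first index would have the same image under π at their initial
        -- positions.
        have ha : Function.Injective fun i => (q i).1 := by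
          intro i i' h
          have e1 := congrFun (hq i) ⟨0, by omega⟩
          have e2 := congrFun (hq i') ⟨0, by omega⟩
          simp only [blockIndex, hk, if_true] at e1 e2 h
          rw [h, ← e2] at e1
          exact congrArg Prod.fst (finProdFinEquiv.injective (π.injective e1))
        have hb : Function.Injective fun i => (q i).2 := by
          intro i i' h
          have e1 := congrFun (hq i) ⟨k, by omega⟩
          have e2 := congrFun (hq i') ⟨k, by omega⟩
          simp only [blockIndex, lt_irrefl, if_false] at e1 e2 h
          rw [h, ← e2] at e1
          exact congrArg Prod.fst (finProdFinEquiv.injective (π.injective e1))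
        refine ⟨(Equiv.ofBijective _ (Finite.injective_iff_bijective.1 ha),
          Equiv.ofBijective _ (Finite.injective_iff_bijective.1 hb)), by simp, ?_⟩
        ext1 t
        obtain ⟨⟨i, l⟩, rfl⟩ := finProdFinEquiv.surjective t
        have e1 := congrFun (blockPerm_apply k d
          (Equiv.ofBijective _ (Finite.injective_iff_bijective.1 ha),
          Equiv.ofBijective _ (Finite.injective_iff_bijective.1 hb)) i) l
        have e2 := congrFun (hq i) l
        exact e1.trans e2.symm
      · push Not at hall
        obtain ⟨i, hi⟩ := hall
        rw [Finset.prod_eq_zero (Finset.mem_univ i), mul_zero]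
        exact blockTensor_eq_zero fun a b => hi (a, b)
    · intro p _
      rw [sign_blockPerm]
      congr 1
      refine Finset.prod_congr rfl fun i _ => ?_
      rw [blockPerm_apply, blockTensor_blockIndex hk]
  rw [h1, ← h2, Fintype.sum_prod_type_right]
  -- With τ = αβ⁻¹ and the factors reindexed by β, the inner sum no longer depends on β; this is the
  -- source of d!.
  have h3 : ∀ β : Equiv.Perm (Fin d), ∑ α : Equiv.Perm (Fin d),
      MvPolynomial.C (((Equiv.Perm.sign (α * β⁻¹) ^ k : ℤˣ) : ℤ) : ℂ) *
        ∏ i, (MvPolynomial.X (α i, β i) : MvPolynomial (Fin d × Fin d) ℂ) =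
      ∑ τ : Equiv.Perm (Fin d), MvPolynomial.C (((Equiv.Perm.sign τ ^ k : ℤˣ) : ℤ) : ℂ) *
          ∏ i, MvPolynomial.X (τ i, i) := by
    intro β
    refine Fintype.sum_equiv (Equiv.mulRight β⁻¹) _ _ fun α => ?_
    congr 1
    refine Fintype.prod_equiv β _ _ fun i => ?_
    simp
  rw [Finset.sum_congr rfl fun β _ => h3 β, Finset.sum_const, Finset.card_univ,
    Fintype.card_perm, Fintype.card_fin, nsmul_eq_mul]

theorem aeval_blockTensor_hyperpfaffian_even {k : ℕ} (hk : 0 < k) (he : Even k) (d : ℕ) :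
    MvPolynomial.aeval (blockTensor k d) (hyperpfaffian k d) =
      (d.factorial : MvPolynomial (Fin d × Fin d) ℂ) *
        (Matrix.mvPolynomialX (Fin d) (Fin d) ℂ).permanent := by
  rw [aeval_blockTensor_hyperpfaffian hk, Matrix.permanent]
  refine congrArg _ (Finset.sum_congr rfl fun τ _ => ?_)
  simp [Int.units_pow_eq_pow_mod_two _ k, Nat.even_iff.1 he]

theorem aeval_blockTensor_hyperpfaffian_odd {k : ℕ} (ho : Odd k) (d : ℕ) :
    MvPolynomial.aeval (blockTensor k d) (hyperpfaffian k d) =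
      (d.factorial : MvPolynomial (Fin d × Fin d) ℂ) *
        (Matrix.mvPolynomialX (Fin d) (Fin d) ℂ).det := by
  rw [aeval_blockTensor_hyperpfaffian ho.pos, Matrix.det_apply']
  refine congrArg _ (Finset.sum_congr rfl fun τ _ => ?_)
  simp [Int.units_pow_eq_pow_mod_two _ k, Nat.odd_iff.1 ho]

/-! ### From permanents to projections of hyperpfaffians -/

/-- A polynomial is a projection of a nonzero multiple of a hyperpfaffian if suitable multiples of
it are permanents of matrices of variables and constants. -/
theorem isProjection_hyperpfaffian {σ : Type} {k : ℕ} (hk : 0 < k) (he : Even k) {c : ℂ}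
    (hc : c ≠ 0) {d : ℕ} {f : MvPolynomial σ ℂ} (h : ∀ c' : ℂ, ∃ A : Fin d → Fin d → σ ⊕ ℂ,
      (Matrix.of fun i j => symbolPoly (A i j)).permanent = MvPolynomial.C c' * f) :
    IsProjection f (MvPolynomial.C c * hyperpfaffian k d) := by
  classical
  -- This scalar cancels both the scaling `c` and the d! from the block tensor.
  obtain ⟨A, hA⟩ := h (c * d.factorial)⁻¹
  have hd : (d.factorial : ℂ) ≠ 0 := Nat.cast_ne_zero.2 (Nat.factorial_ne_zero _)
  -- Every coordinate of the block tensor is a variable or 0, so the composed substitution is again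
  -- a projection.
  have ha : ∀ a : TensorIndex k d, ∃ x : σ ⊕ ℂ, symbolPoly x =
      MvPolynomial.aeval (fun p : Fin d × Fin d => symbolPoly (A p.1 p.2)) (blockTensor k d a) := by
    intro a
    by_cases hall : ∀ i j, a ≠ blockIndex k d i j
    · exact ⟨Sum.inr 0, by simp [blockTensor_eq_zero hall, symbolPoly]⟩
    · push Not at hall
      obtain ⟨i, j, rfl⟩ := hall
      exact ⟨A i j, by rw [blockTensor_blockIndex hk, MvPolynomial.aeval_X]⟩
  choose x hx using ha
  refine ⟨x, ?_⟩
  change f = MvPolynomial.aeval (fun a => symbolPoly (x a)) _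
  have h1 := congrArg (MvPolynomial.aeval fun p : Fin d × Fin d => symbolPoly (A p.1 p.2))
    (aeval_blockTensor_hyperpfaffian_even hk he d)
  rw [MvPolynomial.comp_aeval_apply] at h1
  have h2 : MvPolynomial.aeval (fun p : Fin d × Fin d => symbolPoly (A p.1 p.2))
      (Matrix.mvPolynomialX (Fin d) (Fin d) ℂ).permanent =
      (Matrix.of fun i j => symbolPoly (A i j)).permanent := by
    simp [Matrix.permanent, map_sum, map_prod]
  rw [map_mul, map_natCast, h2, hA] at h1
  simp only [hx]
  rw [map_mul, h1, MvPolynomial.aeval_C, MvPolynomial.algebraMap_eq,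
    ← map_natCast (MvPolynomial.C (σ := σ) (R := ℂ)), ← mul_assoc, ← mul_assoc, ← map_mul,
    ← map_mul, mul_inv_cancel₀ (mul_ne_zero hc hd), map_one, one_mul]

end

noncomputable section

/-! ### Building circuits -/

/-- Renumbering the earlier gates. -/
def ArithGate.map {F σ : Type} {m m' : ℕ} (r : Fin m → Fin m') : ArithGate F σ m → ArithGate F σ m'
  | .var x => .var x
  | .const c => .const c
  | .add i j => .add (r i) (r j)
  | .mul i j => .mul (r i) (r j)

theorem ArithGate.value_map {F σ : Type} [CommSemiring F] {m m' : ℕ} (r : Fin m → Fin m')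
    (v : Fin m' → MvPolynomial σ F) (g : ArithGate F σ m) :
    (g.map r).value v = g.value fun i => v (r i) := by
  cases g <;> rfl

theorem ArithCircuit.exists_append {F σ : Type} [CommSemiring F] {s t : ℕ}
    (Γ : ArithCircuit F σ s) (Δ : ArithCircuit F σ t) :
    ∃ Θ : ArithCircuit F σ (s + t), (∀ i, Θ.value (Fin.castAdd t i) = Γ.value i) ∧
      ∀ j, Θ.value (Fin.natAdd s j) = Δ.value j := by
  induction Δ with
  | nil => exact ⟨Γ, fun i => rfl, fun j => j.elim0⟩
  | @snoc t Δ g ih =>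
    obtain ⟨Θ, h1, h2⟩ := ih
    refine ⟨Θ.snoc (g.map (Fin.natAdd s)), fun i => ?_, fun j => ?_⟩
    · rw [← h1 i]
      exact Θ.value_snoc_castSucc _ (Fin.castAdd t i)
    · refine Fin.lastCases ?_ (fun j => ?_) j
      · rw [Δ.value_snoc_last]
        refine (Θ.value_snoc_last _).trans ?_
        rw [ArithGate.value_map, funext h2]
      · rw [Δ.value_snoc_castSucc, ← h2 j]
        exact Θ.value_snoc_castSucc _ (Fin.natAdd s j)

/-- `f` has a circuit with at most `s` gates and degree at most `d`. -/
def HasCost {σ : Type} (f : MvPolynomial σ ℂ) (s d : ℕ) : Prop :=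
  (∃ s' ≤ s, HasCircuitOfSize f s') ∧ f.totalDegree ≤ d

namespace HasCost

variable {σ : Type} {f g : MvPolynomial σ ℂ} {s t d e : ℕ}

theorem mono (h : HasCost f s d) (hs : s ≤ t) (hd : d ≤ e) : HasCost f t e := by
  obtain ⟨⟨s', hs', h⟩, h'⟩ := h
  exact ⟨⟨s', hs'.trans hs, h⟩, h'.trans hd⟩

theorem X (x : σ) : HasCost (MvPolynomial.X x) 1 1 :=
  ⟨⟨1, le_rfl, ArithCircuit.nil.snoc (.var x), Fin.last 0, ArithCircuit.value_snoc_last _ _⟩,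
    (MvPolynomial.totalDegree_X x).le⟩

theorem C (c : ℂ) : HasCost (MvPolynomial.C c : MvPolynomial σ ℂ) 1 0 :=
  ⟨⟨1, le_rfl, ArithCircuit.nil.snoc (.const c), Fin.last 0, ArithCircuit.value_snoc_last _ _⟩,
    (MvPolynomial.totalDegree_C c).le⟩

theorem add (hf : HasCost f s d) (hg : HasCost g t d) : HasCost (f + g) (s + t + 1) d := by
  obtain ⟨⟨s', hs, Γ, i, hi⟩, hd⟩ := hf
  obtain ⟨⟨t', ht, Δ, j, hj⟩, he⟩ := hg
  obtain ⟨Θ, h1, h2⟩ := Γ.exists_append Δ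
  refine ⟨⟨s' + t' + 1, by omega, Θ.snoc (.add (Fin.castAdd t' i) (Fin.natAdd s' j)),
    Fin.last _, ?_⟩, (MvPolynomial.totalDegree_add _ _).trans (max_le hd he)⟩
  rw [ArithCircuit.value_snoc_last, ArithGate.value, h1, h2, hi, hj]

theorem mul (hf : HasCost f s d) (hg : HasCost g t e) : HasCost (f * g) (s + t + 1) (d + e) := by
  obtain ⟨⟨s', hs, Γ, i, hi⟩, hd⟩ := hf
  obtain ⟨⟨t', ht, Δ, j, hj⟩, he⟩ := hg
  obtain ⟨Θ, h1, h2⟩ := Γ.exists_append Δ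
  refine ⟨⟨s' + t' + 1, by omega, Θ.snoc (.mul (Fin.castAdd t' i) (Fin.natAdd s' j)),
    Fin.last _, ?_⟩, (MvPolynomial.totalDegree_mul _ _).trans (add_le_add hd he)⟩
  rw [ArithCircuit.value_snoc_last, ArithGate.value, h1, h2, hi, hj]

theorem finsetSum {J : Type} (S : Finset J) {f : J → MvPolynomial σ ℂ}
    (hf : ∀ j, HasCost (f j) s d) : HasCost (∑ j ∈ S, f j) (S.card * (s + 1) + 1) d := by
  classical
  induction S using Finset.induction_on with
  | empty => simpa using (C (σ := σ) 0).mono le_rfl (Nat.zero_le d)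
  | insert j S hj ih =>
    rw [Finset.sum_insert hj, Finset.card_insert_of_notMem hj]
    exact ((hf j).add ih).mono (by ring_nf; omega) le_rfl

theorem finsetProd {J : Type} (S : Finset J) {f : J → MvPolynomial σ ℂ}
    (hf : ∀ j, HasCost (f j) s d) :
    HasCost (∏ j ∈ S, f j) (S.card * (s + 1) + 1) (S.card * d) := by
  classical
  induction S using Finset.induction_on with
  | empty => simpa using C (σ := σ) 1
  | insert j S hj ih =>
    rw [Finset.prod_insert hj, Finset.card_insert_of_notMem hj]
    exact ((hf j).mul ih).mono (by ring_nf; omega) (by ring_nf; omega)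

theorem sum {J : Type} [Fintype J] {f : J → MvPolynomial σ ℂ} {N : ℕ} (hN : Fintype.card J = N)
    (hf : ∀ j, HasCost (f j) s d) : HasCost (∑ j, f j) (N * (s + 1) + 1) d :=
  hN ▸ finsetSum Finset.univ hf

theorem prod {J : Type} [Fintype J] {f : J → MvPolynomial σ ℂ} {N : ℕ} (hN : Fintype.card J = N)
    (hf : ∀ j, HasCost (f j) s d) : HasCost (∏ j, f j) (N * (s + 1) + 1) (N * d) :=
  hN ▸ finsetProd Finset.univ hf

end HasCost

end

noncomputable section

/-! ### Sums over permutations as boolean sums -/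

/-- On 0-1-matrices, the indicator function of the matrices with a single `1` in each row. -/
def rowFactor {A : Type} [CommRing A] [Algebra ℂ A] {N : ℕ} (E : Fin N → Fin N → A) : A :=
  ∏ i, ∑ j, E i j * ∏ j', if j' = j then algebraMap ℂ A 1 else
    algebraMap ℂ A 1 + algebraMap ℂ A (-1) * E i j'

/-- The sign of the difference `j' - j`. -/
def orderSign {N : ℕ} (j j' : Fin N) : ℂ := if j < j' then 1 else if j' < j then -1 else 0

/-- On the 0-1-matrices of functions, the sign of a permutation and `0` for other functions. -/
def signFactor {A : Type} [CommRing A] [Algebra ℂ A] {N : ℕ} (E : Fin N → Fin N → A) : A :=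
  ∏ i, ∏ i', if i < i' then ∑ j, ∑ j', algebraMap ℂ A (orderSign j j') * (E i j * E i' j') else
    algebraMap ℂ A 1

/-- On the 0-1-matrices of permutations, the monomials of the hyperpfaffian. -/
def blockFactor {A : Type} [CommRing A] {k n : ℕ} (x : TensorIndex k n → A)
    (E : Fin (n * (2 * k)) → Fin (n * (2 * k)) → A) : A :=
  ∏ i : Fin n, ∑ a, x a * ∏ j : Fin (2 * k), E (finProdFinEquiv (i, j)) (a j)

/-- Compatibility with algebra maps lets the factors be evaluated after 0-1-values are substituted
for the matrix variables. -/
theorem map_rowFactor {A A' : Type} [CommRing A] [Algebra ℂ A] [CommRing A'] [Algebra ℂ A']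
    (φ : A →ₐ[ℂ] A') {N : ℕ} (E : Fin N → Fin N → A) :
    φ (rowFactor E) = rowFactor fun i j => φ (E i j) := by
  simp only [rowFactor, map_prod, map_sum, map_mul, apply_ite φ, map_add, AlgHom.commutes]

theorem map_signFactor {A A' : Type} [CommRing A] [Algebra ℂ A] [CommRing A'] [Algebra ℂ A']
    (φ : A →ₐ[ℂ] A') {N : ℕ} (E : Fin N → Fin N → A) :
    φ (signFactor E) = signFactor fun i j => φ (E i j) := by
  simp only [signFactor, map_prod, map_sum, map_mul, apply_ite φ, AlgHom.commutes]

theorem map_blockFactor {A A' : Type} [CommRing A] [Algebra ℂ A] [CommRing A'] [Algebra ℂ A']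
    (φ : A →ₐ[ℂ] A') {k n : ℕ} (x : TensorIndex k n → A)
    (E : Fin (n * (2 * k)) → Fin (n * (2 * k)) → A) :
    φ (blockFactor x E) = blockFactor (fun a => φ (x a)) fun i j => φ (E i j) := by
  simp only [blockFactor, map_prod, map_sum, map_mul]

section indicator

variable {A : Type} [CommRing A] [Algebra ℂ A]

theorem rowFactor_indicator {N : ℕ} (h : Fin N → Fin N) :
    rowFactor (fun i j => if h i = j then (1 : A) else 0) = 1 := by
  refine Finset.prod_eq_one fun i _ => ?_
  rw [Finset.sum_eq_single (h i)]
  · beta_reduce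
    rw [if_pos rfl, one_mul]
    refine Finset.prod_eq_one fun j' _ => ?_
    split_ifs with h1 h2
    · simp
    · exact absurd h2.symm h1
    · simp
  · intro j _ hj
    beta_reduce
    rw [if_neg (Ne.symm hj), zero_mul]
  · simp

/-- In every row some summand is nonzero, which forces its entry to be 1 and all others in the row
to be 0. -/
theorem exists_eq_indicator_of_rowFactor_ne_zero {N : ℕ} {e : Fin N → Fin N → Bool}
    (he : rowFactor (fun i j => if e i j then (1 : A) else 0) ≠ 0) :
    ∃ h : Fin N → Fin N, ∀ i j, e i j = decide (h i = j) := by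
  have h1 : ∀ i, ∃ j, e i j = true ∧ ∀ j', j' ≠ j → e i j' = false := by
    intro i
    have h2 : (∑ j, (if e i j then (1 : A) else 0) * ∏ j', if j' = j then algebraMap ℂ A 1 else
        algebraMap ℂ A 1 + algebraMap ℂ A (-1) * (if e i j' then (1 : A) else 0)) ≠ 0 := by
      intro h0
      exact he (Finset.prod_eq_zero (Finset.mem_univ i) h0)
    obtain ⟨j, -, hj⟩ := Finset.exists_ne_zero_of_sum_ne_zero h2
    refine ⟨j, ?_, fun j' hj' => ?_⟩
    · by_contra h3
      simp [h3] at hj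
    · by_contra h3
      apply hj
      rw [Finset.prod_eq_zero (Finset.mem_univ j'), mul_zero]
      simp [hj', Bool.eq_true_of_not_eq_false h3]
  choose h hh using h1
  refine ⟨h, fun i j => ?_⟩
  by_cases hj : h i = j
  · subst hj; simp [(hh i).1]
  · simp [hj, (hh i).2 j (Ne.symm hj)]

theorem signFactor_indicator {N : ℕ} (h : Fin N → Fin N) :
    signFactor (fun i j => if h i = j then (1 : A) else 0) =
      ∏ i, ∏ i', if i < i' then algebraMap ℂ A (orderSign (h i) (h i')) else 1 := by
  refine Finset.prod_congr rfl fun i _ => Finset.prod_congr rfl fun i' _ => ?_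
  split_ifs
  · simp
  · simp

/-- The sign is the product over i < i' of the signs of π(i') - π(i). -/
theorem signFactor_indicator_perm {N : ℕ} (π : Equiv.Perm (Fin N)) :
    signFactor (fun i j => if π i = j then (1 : A) else 0) =
      algebraMap ℂ A ((Equiv.Perm.sign π : ℤ) : ℂ) := by
  rw [signFactor_indicator, Equiv.Perm.sign_eq_prod_prod_Ioi]
  simp only [Units.coe_prod, Int.cast_prod, map_prod]
  refine Finset.prod_congr rfl fun i _ => ?_
  rw [← Finset.prod_filter]
  have hf : Finset.univ.filter (fun i' => i < i') = Finset.Ioi i := by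
    ext; simp
  rw [hf]
  refine Finset.prod_congr rfl fun i' hi' => ?_
  have hne : π i ≠ π i' := fun h => (Finset.mem_Ioi.1 hi').ne (π.injective h)
  rw [orderSign]
  split_ifs with h1 h2
  · simp
  · simp
  · exact absurd (le_antisymm (not_lt.1 h2) (not_lt.1 h1)) hne

theorem injective_of_signFactor_ne_zero {N : ℕ} {h : Fin N → Fin N}
    (hs : signFactor (fun i j => if h i = j then (1 : A) else 0) ≠ 0) : Function.Injective h := by
  rw [signFactor_indicator] at hs
  have key : ∀ i i', i < i' → h i ≠ h i' := by
    intro i i' hlt heq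
    apply hs
    refine Finset.prod_eq_zero (Finset.mem_univ i) (Finset.prod_eq_zero (Finset.mem_univ i') ?_)
    rw [if_pos hlt, heq]
    simp [orderSign]
  intro i i' heq
  by_contra hne
  rcases lt_or_gt_of_ne hne with hlt | hlt
  · exact key i i' hlt heq
  · exact key i' i hlt heq.symm

end indicator

theorem blockFactor_indicator {A : Type} [CommRing A] {k n : ℕ} (x : TensorIndex k n → A)
    (h : Fin (n * (2 * k)) → Fin (n * (2 * k))) :
    blockFactor x (fun i j => if h i = j then (1 : A) else 0) =
      ∏ i : Fin n, x fun j => h (finProdFinEquiv (i, j)) := by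
  refine Finset.prod_congr rfl fun i _ => ?_
  rw [Finset.sum_eq_single fun j => h (finProdFinEquiv (i, j))]
  · simp
  · intro a _ ha
    obtain ⟨j, hj⟩ := Function.ne_iff.1 ha
    rw [Finset.prod_eq_zero (Finset.mem_univ j), mul_zero]
    exact if_neg (Ne.symm hj)
  · simp

/-- The polynomial whose boolean sum is a multiple of the hyperpfaffian. -/
def hyperpfaffianWitness (k n : ℕ) (c : ℂ) :
    MvPolynomial (TensorIndex k n ⊕ Fin (n * (2 * k) * (n * (2 * k)))) ℂ :=
  MvPolynomial.C c *
    (rowFactor (fun i j => MvPolynomial.X (Sum.inr (finProdFinEquiv (i, j)))) *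
    (signFactor (fun i j => MvPolynomial.X (Sum.inr (finProdFinEquiv (i, j)))) *
    blockFactor (fun a => MvPolynomial.X (Sum.inl a))
      (fun i j => MvPolynomial.X (Sum.inr (finProdFinEquiv (i, j))))))

theorem booleanSum_hyperpfaffianWitness (k n : ℕ) (c : ℂ) :
    booleanSum (hyperpfaffianWitness k n c) = MvPolynomial.C c * hyperpfaffian k n := by
  let A := MvPolynomial (TensorIndex k n) ℂ
  let E : (Fin (n * (2 * k) * (n * (2 * k))) → Bool) → Fin (n * (2 * k)) → Fin (n * (2 * k)) → A :=
    fun e i j => if e (finProdFinEquiv (i, j)) then 1 else 0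
  have h1 : booleanSum (hyperpfaffianWitness k n c) = ∑ e, MvPolynomial.C c *
      (rowFactor (E e) * (signFactor (E e) *
        blockFactor (fun a => (MvPolynomial.X a : A)) (E e))) := by
    rw [booleanSum]
    refine Finset.sum_congr rfl fun e _ => ?_
    rw [hyperpfaffianWitness, map_mul, map_mul, map_mul, map_rowFactor, map_signFactor,
      map_blockFactor]
    simp only [MvPolynomial.aeval_X, Sum.elim_inl, Sum.elim_inr, MvPolynomial.aeval_C,
      MvPolynomial.algebraMap_eq]
    rfl
  rw [h1, hyperpfaffian, Finset.mul_sum]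
  symm
  -- Only permutation matrices survive: the row factor leaves the matrices of functions, and the
  -- sign factor vanishes if two values coincide.
  refine Finset.sum_of_injOn (fun π t => decide (π (finProdFinEquiv.symm t).1 =
    (finProdFinEquiv.symm t).2)) ?_ (by simp) ?_ ?_
  · intro π _ π' _ h
    ext1 i
    have := congrFun h (finProdFinEquiv (i, π i))
    simp only [Equiv.symm_apply_apply, decide_true] at this
    exact (of_decide_eq_true this.symm).symm
  · intro e _ he
    by_contra h0
    have hrow : rowFactor (E e) ≠ 0 := fun h => h0 (by rw [h]; ring)
    obtain ⟨h, hh⟩ := exists_eq_indicator_of_rowFactor_ne_zero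
      (e := fun i j => e (finProdFinEquiv (i, j))) hrow
    have hE : E e = fun i j => if h i = j then (1 : A) else 0 := by
      funext i j
      simp only [E, hh, decide_eq_true_eq]
    have hsign : signFactor (E e) ≠ 0 := fun h => h0 (by rw [h]; ring)
    rw [hE] at hsign
    apply he
    refine ⟨Equiv.ofBijective h (Finite.injective_iff_bijective.1
      (injective_of_signFactor_ne_zero hsign)), by simp, ?_⟩
    funext t
    have := hh (finProdFinEquiv.symm t).1 (finProdFinEquiv.symm t).2
    simp only [Prod.mk.eta, Equiv.apply_symm_apply] at this
    rw [this]
    rfl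
  · intro π _
    have hE : E (fun t => decide (π (finProdFinEquiv.symm t).1 = (finProdFinEquiv.symm t).2)) =
        fun i j => if π i = j then (1 : A) else 0 := by
      funext i j
      simp only [E, Equiv.symm_apply_apply, decide_eq_true_eq]
    rw [hE, rowFactor_indicator, signFactor_indicator_perm, blockFactor_indicator, one_mul]
    rfl

/-! ### Hyperpfaffians are in VNP -/

theorem hasCost_rowFactor {σ : Type} {N : ℕ} (x : Fin N → Fin N → σ) :
    HasCost (rowFactor fun i j => (MvPolynomial.X (x i j) : MvPolynomial σ ℂ))
      (N * (N * (1 + (N * (5 + 1) + 1) + 1 + 1) + 1 + 1) + 1) (N * (1 + N * 1)) := by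
  refine .prod (Fintype.card_fin N) fun i => .sum (Fintype.card_fin N) fun j =>
    (HasCost.X _).mul (.prod (Fintype.card_fin N) fun j' => ?_)
  split_ifs
  · exact (HasCost.C 1).mono (by norm_num) (by norm_num)
  · exact ((HasCost.C 1).mono le_rfl (Nat.zero_le 1)).add
      (((HasCost.C (-1)).mul (HasCost.X _)).mono le_rfl (by norm_num))

theorem hasCost_signFactor {σ : Type} {N : ℕ} (x : Fin N → Fin N → σ) :
    HasCost (signFactor fun i j => (MvPolynomial.X (x i j) : MvPolynomial σ ℂ))
      (N * (N * (N * (N * (5 + 1) + 1 + 1) + 1 + 1) + 1 + 1) + 1) (N * (N * 2)) := by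
  refine .prod (Fintype.card_fin N) fun i => .prod (Fintype.card_fin N) fun i' => ?_
  split_ifs
  · refine .sum (Fintype.card_fin N) fun j => .sum (Fintype.card_fin N) fun j' => ?_
    exact ((HasCost.C _).mul ((HasCost.X _).mul (HasCost.X _))).mono (by norm_num) (by norm_num)
  · exact (HasCost.C 1).mono (by omega) (by norm_num)

theorem hasCost_blockFactor {σ : Type} {k n T : ℕ} (hT : Fintype.card (TensorIndex k n) = T)
    (y : TensorIndex k n → σ) (x : Fin (n * (2 * k)) → Fin (n * (2 * k)) → σ) :
    HasCost (blockFactor (fun a => (MvPolynomial.X (y a) : MvPolynomial σ ℂ))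
        fun i j => MvPolynomial.X (x i j))
      (n * (T * (1 + (2 * k * (1 + 1) + 1) + 1 + 1) + 1 + 1) + 1) (n * (1 + 2 * k * 1)) :=
  .prod (Fintype.card_fin n) fun _ => .sum hT fun _ =>
    (HasCost.X _).mul (.prod (Fintype.card_fin (2 * k)) fun _ => HasCost.X _)

theorem card_tensorIndex (k n : ℕ) : Fintype.card (TensorIndex k n) = (n * (2 * k)) ^ (2 * k) := by
  simp [TensorIndex]

theorem totalDegree_hyperpfaffian_le (k n : ℕ) : (hyperpfaffian k n).totalDegree ≤ n := by
  refine MvPolynomial.totalDegree_finsetSum_le fun π _ => ?_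
  refine (MvPolynomial.totalDegree_mul _ _).trans ?_
  rw [MvPolynomial.totalDegree_C, zero_add]
  refine (MvPolynomial.totalDegree_finsetProd _ _).trans ?_
  simp

theorem isVNP_hyperpfaffian (k : ℕ) (c : ℕ → ℂ) :
    IsVNP fun n => MvPolynomial.C (c n) * hyperpfaffian k n := by
  have hN : PBounded fun n => n * (2 * k) := PBounded.id.mul (.const _)
  -- Here it matters that `k` is fixed: the number of tensor coordinates is then polynomial in `n`.
  have hT : PBounded fun n => (n * (2 * k)) ^ (2 * k) := hN.pow _
  have hcard : PBounded fun n => Fintype.card (TensorIndex k n) :=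
    hT.mono fun n => (card_tensorIndex k n).le
  refine ⟨⟨hcard, PBounded.id.mono fun n => ?_⟩, fun n => n * (2 * k) * (n * (2 * k)),
    fun n => hyperpfaffianWitness k n (c n), ?_, fun n =>
      (booleanSum_hyperpfaffianWitness k n (c n)).symm⟩
  · refine (MvPolynomial.totalDegree_mul _ _).trans ?_
    rw [MvPolynomial.totalDegree_C, zero_add]
    exact totalDegree_hyperpfaffian_le k n
  · have hcost := fun n => (HasCost.C (c n)).mul
      ((hasCost_rowFactor fun i j : Fin (n * (2 * k)) =>
        (Sum.inr (finProdFinEquiv (i, j)) :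
          TensorIndex k n ⊕ Fin (n * (2 * k) * (n * (2 * k))))).mul
      ((hasCost_signFactor fun i j => Sum.inr (finProdFinEquiv (i, j))).mul
      (hasCost_blockFactor (card_tensorIndex k n) Sum.inl
        fun i j => Sum.inr (finProdFinEquiv (i, j)))))
    have hk : ∀ c : ℕ, PBounded fun _ => c := PBounded.const
    refine ⟨⟨?_, PBounded.mono ?_ fun n => (hcost n).2⟩, ?_⟩
    · refine (hcard.add (hN.mul hN)).mono fun n => ?_
      simp
    · exact (hk 0).add ((hN.mul ((hk 1).add (hN.mul (hk 1)))).add ((hN.mul (hN.mul (hk 2))).add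
        (PBounded.id.mul ((hk 1).add (hk (2 * k * 1))))))
    · choose s hs hcirc using fun n => (hcost n).1
      refine ⟨s, PBounded.mono ?_ hs, hcirc⟩
      have hrow := (hN.mul ((hN.mul ((((hk 1).add ((hN.mul (hk (5 + 1))).add (hk 1))).add
        (hk 1)).add (hk 1))).add (hk 1) |>.add (hk 1))).add (hk 1)
      have hsign := (hN.mul (((hN.mul (((hN.mul (((hN.mul (hk (5 + 1))).add (hk 1)).add
        (hk 1))).add (hk 1)).add (hk 1))).add (hk 1)).add (hk 1))).add (hk 1)
      have hblock := (PBounded.id.mul (((hT.mul (hk (1 + (2 * k * (1 + 1) + 1) + 1 + 1))).add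
        (hk 1)).add (hk 1))).add (hk 1)
      exact ((hk 1).add ((hrow.add ((hsign.add hblock).add (hk 1))).add (hk 1))).add (hk 1)

/-! ### Completeness -/

theorem isPProjection_hyperpfaffian {k : ℕ} (hk : 0 < k) (he : Even k) {c : ℕ → ℂ}
    (hc : ∀ n, c n ≠ 0) (σ : ℕ → Type) [∀ n, Fintype (σ n)] (f : ∀ n, MvPolynomial (σ n) ℂ)
    (hf : IsVNP f) : IsPProjection f fun n => MvPolynomial.C (c n) * hyperpfaffian k n := by
  obtain ⟨-, u, g, ⟨⟨hcard, hdeg⟩, s, hs, hcirc⟩, hfg⟩ := hf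
  choose d hd h using fun n => exists_permanent_eq_booleanSum (g n) (hcirc n)
  have hcard' : ∀ n, Fintype.card (σ n ⊕ Fin (u n)) = Fintype.card (σ n) + u n := fun n => by
    simp
  have ha : PBounded fun n => Fintype.card (σ n) := hcard.mono fun n => by
    rw [hcard']; omega
  -- The number of summation variables is bounded because they are among the variables of `g n`.
  have hu : PBounded u := hcard.mono fun n => by
    rw [hcard']; omega
  refine ⟨d, (PBounded.permanentBound hs ha hu hdeg).mono hd, fun n => ?_⟩
  rw [hfg n]
  exact isProjection_hyperpfaffian hk he (hc (d n)) (h n)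

end

theorem mainTheorem3 (k : ℕ) (hk : 0 < k) :
    (Even k → ∀ c : ℕ → ℂ, (∀ n, c n ≠ 0) →
      IsVNPComplete (fun n => MvPolynomial.C (c n) * hyperpfaffian k n)) ∧
    (Even k → ∀ d : ℕ,
      MvPolynomial.aeval (blockTensor k d) (hyperpfaffian k d) =
        (d.factorial : MvPolynomial (Fin d × Fin d) ℂ) *
          (Matrix.mvPolynomialX (Fin d) (Fin d) ℂ).permanent) ∧
    (Odd k → ∀ d : ℕ,
      MvPolynomial.aeval (blockTensor k d) (hyperpfaffian k d) =
        (d.factorial : MvPolynomial (Fin d × Fin d) ℂ) *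
          (Matrix.mvPolynomialX (Fin d) (Fin d) ℂ).det) := by
  refine ⟨fun he c hc => ⟨isVNP_hyperpfaffian k c, fun σ _ f hf =>
      isPProjection_hyperpfaffian hk he hc σ f hf⟩,
    fun he d => aeval_blockTensor_hyperpfaffian_even hk he d,
    fun ho d => aeval_blockTensor_hyperpfaffian_odd ho d⟩
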